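/- Let $0<\alpha<1$ and $\tau_0>0$ be fixed, and let $\mathcal P$ be a Poisson point process on $\mathbb R$ with intensity measure $\alpha e^{-\alpha E}\,dE$. Almost surely its points can be listed in strictly decreasing order, $E_1>E_2>\cdots$; this list $\underline E=(E_i)_{i\ge1}$ is the energy landscape. Put $\tau_i=e^{E_i}/\tau_0$, $x_i=1/\tau_i=\tau_0e^{-E_i}$ and, for $E\in\mathbb R$, $N_E=\#\{i: E_i\ge E\}$. Given $\underline E$ and $E$ with $N_E\ge2$, let $Y_E$ be the continuous-time random walk on $\{1,\dots,N_E\}$ that starts from the uniform distribution, waits at a site $i$ an exponential time of mean $\frac{N_E}{N_E-1}\tau_i$ and then jumps to a uniformly chosen different site. Let $\mathbb P_E$ be its law, let $x_E(t)=x_k$ if $Y_E(t)=k$, and let $$\Pi_E(t,t_w)=\mathbb P_E\bigl(Y_E(s)=Y_E(t_w)\ \text{ for all } s\in[t_w,t_w+t]\bigr).$$ Then for almost every landscape $\underline E$ one has $\sum_{i\ge1}\tau_i<\infty$ and $$\lim_{t\uparrow\infty}\,\lim_{E\downarrow-\infty}\mathbb P_E\bigl(x_E(t)=x_j\bigr)=\frac{\tau_j}{\sum_{k\ge1}\tau_k}\qquad\text{for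 all } j\ge1,$$ $$\lim_{t_w\uparrow\infty}\,\lim_{E\downarrow-\infty}\Pi_E(\theta t_w,t_w)=0\qquad\text{for all }\theta>0,$$ $$\lim_{t_w\uparrow\infty}\,\lim_{E\downarrow-\infty}\Pi_E(t,t_w)=\frac{\sum_{i\ge1}\tau_ie^{-x_it}}{\sum_{i\ge1}\tau_i}\qquad\text{for all } t>0,$$ where in each case the inner limit exists for every positive value of the outer variable ($t$, respectively $t_w$). -/

import Mathlib

open MeasureTheory ProbabilityTheory Filter Topology
open scoped ENNReal NNReal

namespace TrapModel

/-- `P` is a Poisson point process on `X` with intensity measure `ν`, defined on the probability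
space `(Ω, μ)`: a random countable sum of Dirac masses such that the mass of a set of finite
intensity `ν A` is a Poisson variable of parameter `ν A`, and the masses of finitely many pairwise
disjoint sets are independent. -/
structure IsPoissonPointProcess {Ω X : Type*} [MeasurableSpace Ω] [MeasurableSpace X]
    (P : Ω → Measure X) (ν : Measure X) (μ : Measure Ω) : Prop where
  measurable : Measurable P
  sum_dirac : ∀ ω, ∃ (S : Set ℕ) (x : ℕ → X),
    P ω = Measure.sum (fun i : S => Measure.dirac (x i))
  poisson : ∀ A : Set X, MeasurableSet A → ν A ≠ ∞ →
    μ.map (fun ω => P ω A) = (poissonMeasure (ν A).toNNReal).map (Nat.cast : ℕ → ℝ≥0∞)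
  indep : ∀ (n : ℕ) (A : Fin n → Set X), (∀ i, MeasurableSet (A i)) →
    Pairwise (Function.onFun Disjoint A) → iIndepFun (fun i ω => P ω (A i)) μ

/-- The intensity measure `α e^{-α E} dE` on the real line. -/
noncomputable def energyIntensity (α : ℝ) : Measure ℝ :=
  volume.withDensity (fun E => ENNReal.ofReal (α * Real.exp (-α * E)))

/-- The set of points (atoms) of a sum of Dirac masses. -/
def points (m : Measure ℝ) : Set ℝ := {E | m {E} ≠ 0}

/-- `e` lists all the points of `m` in strictly decreasing order: the levels `E_1 > E_2 > ...`
are `e 0 > e 1 > ...`. -/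
def IsLandscape (e : ℕ → ℝ) (m : Measure ℝ) : Prop :=
  StrictAnti e ∧ Set.range e = points m

/-- The rescaled waiting time `τ_i = e^{E_i} / τ₀`. -/
noncomputable def waitingTime (τ₀ : ℝ) (e : ℕ → ℝ) (i : ℕ) : ℝ := Real.exp (e i) / τ₀

/-- The inverse waiting time `x_i = τ₀ e^{-E_i}`. -/
noncomputable def rate (τ₀ : ℝ) (e : ℕ → ℝ) (i : ℕ) : ℝ := τ₀ * Real.exp (-e i)

/-- `N_E`, the number of levels that are at least `E`. The sites of the walk with
threshold `E` are `0, ..., N_E - 1`. -/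
noncomputable def numSites (e : ℕ → ℝ) (E : ℝ) : ℕ := {i | E ≤ e i}.ncard

open Classical in
/-- The uniform law on the finite set `s`; the value `d` is used if `s` is empty (this only
concerns walks with at most one site). -/
noncomputable def uniformLaw (s : Finset ℕ) (d : ℕ) : PMF ℕ :=
  if h : s.Nonempty then PMF.uniformOfFinset s h else PMF.pure d

/-- From `i`, jump to a uniformly chosen site of `{0, ..., N-1}` that is different from `i`. -/
noncomputable def jumpKernel (N : ℕ) : Kernel ℕ ℕ :=
  Kernel.ofFunOfCountable (fun i => (uniformLaw ((Finset.range N).erase i) i).toMeasure)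

instance (N : ℕ) : IsMarkovKernel (jumpKernel N) :=
  ⟨fun i => PMF.toMeasure.isProbabilityMeasure (uniformLaw ((Finset.range N).erase i) i)⟩

/-- The law of the sequence of successively visited sites: the Markov chain with uniform initial
law on `{0, ..., N-1}` and transition kernel `jumpKernel N`. -/
noncomputable def skeletonLaw (N : ℕ) : Measure (ℕ → ℕ) :=
  Kernel.trajMeasure (X := fun _ => ℕ) (uniformLaw (Finset.range N) 0).toMeasure
    (fun n => (jumpKernel N).comap
      (fun h : (Finset.Iic n → ℕ) => h ⟨n, Finset.mem_Iic.2 le_rfl⟩) (measurable_pi_apply _))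

/-- The probability measure that carries the walk: the visited sites, together with an independent
sequence of independent exponential variables of mean `1`. -/
noncomputable def walkMeasure (N : ℕ) : Measure ((ℕ → ℕ) × (ℕ → ℝ)) :=
  (skeletonLaw N).prod (Measure.infinitePi (fun _ : ℕ => expMeasure 1))

/-- The time spent at the `n`-th visited site: given that this site is `i`, it is exponential
with mean `N / (N - 1) * τ i`. -/
noncomputable def holdingTime (N : ℕ) (τ : ℕ → ℝ) (p : (ℕ → ℕ) × (ℕ → ℝ)) (n : ℕ) : ℝ :=
  (N : ℝ) / ((N : ℝ) - 1) * τ (p.1 n) * p.2 n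

/-- The time of the `n`-th jump; it is `0` for `n = 0`. -/
noncomputable def jumpTime (N : ℕ) (τ : ℕ → ℝ) (p : (ℕ → ℕ) × (ℕ → ℝ)) (n : ℕ) : ℝ :=
  ∑ k ∈ Finset.range n, holdingTime N τ p k

/-- The position of the walk at time `t`: the site reached by the last jump that takes place
at or before time `t`. -/
noncomputable def walk (N : ℕ) (τ : ℕ → ℝ) (t : ℝ) (p : (ℕ → ℕ) × (ℕ → ℝ)) : ℕ :=
  p.1 (sSup {n : ℕ | jumpTime N τ p n ≤ t})

/-- The walk `Y_E` in the landscape `e` with time unit `τ₀`. -/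
noncomputable def Y (τ₀ : ℝ) (e : ℕ → ℝ) (E t : ℝ) : (ℕ → ℕ) × (ℕ → ℝ) → ℕ :=
  walk (numSites e E) (waitingTime τ₀ e) t

/-- `ℙ_E (x_E(t) = x_j)`, where `x_E(t) = x_k` if `Y_E(t) = k`. -/
noncomputable def occupationProb (τ₀ : ℝ) (e : ℕ → ℝ) (j : ℕ) (E t : ℝ) : ℝ :=
  (walkMeasure (numSites e E)).real {p | rate τ₀ e (Y τ₀ e E t p) = rate τ₀ e j}

/-- The time-time correlation function
`Π_E (t, t_w) = ℙ_E (Y_E(s) = Y_E(t_w) for all s ∈ [t_w, t_w + t])`. -/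
noncomputable def correlation (τ₀ : ℝ) (e : ℕ → ℝ) (E t tw : ℝ) : ℝ :=
  (walkMeasure (numSites e E)).real
    {p | ∀ s ∈ Set.Icc tw (tw + t), Y τ₀ e E s p = Y τ₀ e E tw p}

/-- `lim_{t → ∞} lim_{E → -∞} F E t = l`: for each `t > 0` the inner limit exists, and
the inner limits converge to `l` as `t → ∞`. -/
def HasIteratedLimit (F : ℝ → ℝ → ℝ) (l : ℝ) : Prop :=
  ∃ g : ℝ → ℝ, (∀ t : ℝ, 0 < t → Tendsto (fun E => F E t) atBot (𝓝 (g t))) ∧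
    Tendsto g atTop (𝓝 l)

end TrapModel

/-!
Between its jumps, the walk on `N` sites loses mass from site `k` at rate `x k = 1 / τ k`, and the
lost mass is redistributed uniformly over all `N` sites (jumps to a different site at rate
`x k * (N - 1) / N` amount to the same thing). So its occupation probabilities solve the linear
system `p k' = (∑ i < N, x i * p i) / N - x k * p k`, started from the uniform law. This is derived
in `TrapModel.isUniformFlow_siteProb` by decomposing according to the number of jumps: the balance
of mass at a site (`TrapModel.siteProb_balance`) follows from the Markov property of the visited
sites and from the lack of memory of the exponential clocks. Conservation of mass in this system
also shows that the walk does not explode.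

The limit of infinitely many sites rests on estimates that are uniform in `N`. Let `E t` be the
squared `L²` distance to equilibrium, with weights `x k`. Its derivative is minus twice the sum of
the squares of the drifts `p k'`. This dissipation dominates `E ^ 2 / 2`, a Nash-type inequality, so
that `E t ≤ 1 / t`; it dominates `x 0 * E`, a spectral gap, so that `E` decays exponentially; and it
controls the drift of each site, so that the flows are equicontinuous away from time `0`. Moreover
the flows with `N` and `M ≥ N` sites differ in `L²` of any bounded time interval by at most a
constant times `∑ j ∈ [N, M), τ j` (`TrapModel.IsUniformFlow.sq_sub_le`). If `∑ k, τ k` is finite,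
this and equicontinuity give convergence at each positive time (`TrapModel.cauchySeq_flow`), and the
uniform spectral gap carries the relaxation to `τ k / ∑ i, τ i` over to the limit
(`TrapModel.tendsto_limitFlow_atTop`).

The correlation function is the sum over `k` of the probability to be at `k` times the probability
`exp (-(x k * (N - 1) / N * t))` not to jump for a time `t` (`TrapModel.walkMeasure_stay`). Since
`exp (-(x k * t)) ≤ τ k / t`, its limits follow by dominated convergence.

For the landscape, the mean measure of the Poisson process above level `a` is `exp (-α * a)`: it is
finite, it tends to infinity as `a → -∞`, and for `α < 1` it is summable against `exp a`. Hence
almost surely the points can be listed in decreasing order and `∑ k, τ k` is finite.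
-/

namespace TrapModel

/-! ### Relaxation of the forward equation -/

lemma le_of_hasDerivAt_nonpos {f f' : ℝ → ℝ} {a b : ℝ} (hab : a ≤ b)
    (hc : ContinuousOn f (Set.Icc a b)) (hd : ∀ t ∈ Set.Ioo a b, HasDerivAt f (f' t) t)
    (hf' : ∀ t ∈ Set.Ioo a b, f' t ≤ 0) : f b ≤ f a := by
  refine antitoneOn_of_deriv_nonpos (convex_Icc a b) hc ?_ ?_ (Set.left_mem_Icc.2 hab)
    (Set.right_mem_Icc.2 hab) hab
  · rw [interior_Icc]
    exact fun t ht => (hd t ht).differentiableAt.differentiableWithinAt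
  · rw [interior_Icc]
    exact fun t ht => (hd t ht).deriv ▸ hf' t ht

/-- `p` solves the forward equation of the trap model on the sites `0, ..., N - 1` with rates `x`,
started from the uniform law: mass leaves each site `k` at rate `x k` and is redistributed uniformly
over all `N` sites, and `p k t` is the mass of `k` at time `t`. -/
structure IsUniformFlow (N : ℕ) (x : ℕ → ℝ) (p : ℕ → ℝ → ℝ) : Prop where
  nonneg : ∀ k t, 0 ≤ t → 0 ≤ p k t
  sum_eq_one : ∀ t, 0 ≤ t → ∑ k ∈ Finset.range N, p k t = 1
  continuousOn : ∀ k < N, ContinuousOn (p k) (Set.Ici 0)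
  initial : ∀ k < N, p k 0 = (N : ℝ)⁻¹
  hasDerivAt : ∀ k < N, ∀ t, 0 < t →
    HasDerivAt (p k) ((∑ i ∈ Finset.range N, x i * p i t) / N - x k * p k t) t

/-- The derivative of the mass of site `k` under the forward equation. -/
noncomputable def drift (N : ℕ) (x : ℕ → ℝ) (p : ℕ → ℝ → ℝ) (k : ℕ) (t : ℝ) : ℝ :=
  (∑ i ∈ Finset.range N, x i * p i t) / N - x k * p k t

/-- The normalization of the equilibrium law, which gives mass `eqConst N x / x k` to site `k`. -/
noncomputable def eqConst (N : ℕ) (x : ℕ → ℝ) : ℝ := (∑ i ∈ Finset.range N, (x i)⁻¹)⁻¹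

/-- The squared distance of the flow to equilibrium, in the `L²` norm with weights `x`; these are
the inverses of the masses of the (unnormalized) reversible measure. -/
noncomputable def energy (N : ℕ) (x : ℕ → ℝ) (p : ℕ → ℝ → ℝ) (t : ℝ) : ℝ :=
  ∑ k ∈ Finset.range N, x k * (p k t - eqConst N x * (x k)⁻¹) ^ 2

section Relaxation

variable {N : ℕ} {x : ℕ → ℝ} {p : ℕ → ℝ → ℝ}

lemma sum_eqConst (hN : 0 < N) (hx : ∀ k, 0 < x k) :
    ∑ k ∈ Finset.range N, eqConst N x * (x k)⁻¹ = 1 := by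
  rw [← Finset.mul_sum, eqConst]
  refine inv_mul_cancel₀ (Finset.sum_pos (fun i _ => inv_pos.2 (hx i)) ?_).ne'
  simpa using hN.ne'

lemma eqConst_nonneg (hx : ∀ k, 0 < x k) : 0 ≤ eqConst N x :=
  inv_nonneg.2 (Finset.sum_nonneg fun i _ => (inv_pos.2 (hx i)).le)

lemma sum_drift (hN : 0 < N) (t : ℝ) : ∑ k ∈ Finset.range N, drift N x p k t = 0 := by
  have : (N : ℝ) ≠ 0 := by positivity
  simp only [drift, Finset.sum_sub_distrib, Finset.sum_const, Finset.card_range, nsmul_eq_mul]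
  field_simp
  ring

lemma energy_nonneg (hx : ∀ k, 0 < x k) (t : ℝ) : 0 ≤ energy N x p t :=
  Finset.sum_nonneg fun k _ => mul_nonneg (hx k).le (sq_nonneg _)

namespace IsUniformFlow

lemma sum_deviation (h : IsUniformFlow N x p) (hN : 0 < N) (hx : ∀ k, 0 < x k) {t : ℝ}
    (ht : 0 ≤ t) : ∑ k ∈ Finset.range N, (p k t - eqConst N x * (x k)⁻¹) = 0 := by
  rw [Finset.sum_sub_distrib, sum_eqConst hN hx, h.sum_eq_one t ht, sub_self]

lemma hasDerivAt_energy (h : IsUniformFlow N x p) (hN : 0 < N) (hx : ∀ k, 0 < x k) {t : ℝ}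
    (ht : 0 < t) :
    HasDerivAt (energy N x p) (-2 * ∑ k ∈ Finset.range N, drift N x p k t ^ 2) t := by
  have h1 : HasDerivAt (energy N x p) (∑ k ∈ Finset.range N,
      x k * (2 * (p k t - eqConst N x * (x k)⁻¹) * drift N x p k t)) t := by
    refine HasDerivAt.fun_sum fun k hk => HasDerivAt.const_mul _ ?_
    simpa [drift] using ((h.hasDerivAt k (Finset.mem_range.1 hk) t ht).sub_const _).fun_pow 2
  convert h1 using 1
  set A := (∑ i ∈ Finset.range N, x i * p i t) / N
  have h2 : ∀ k ∈ Finset.range N, x k * (2 * (p k t - eqConst N x * (x k)⁻¹) * drift N x p k t)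
      = 2 * (A - eqConst N x) * drift N x p k t + -2 * drift N x p k t ^ 2 := by
    intro k _
    have h3 : x k * (p k t - eqConst N x * (x k)⁻¹) = A - drift N x p k t - eqConst N x := by
      rw [drift, mul_sub, mul_left_comm, mul_inv_cancel₀ (hx k).ne']
      ring
    linear_combination 2 * drift N x p k t * h3
  rw [Finset.sum_congr rfl h2, Finset.sum_add_distrib, ← Finset.mul_sum, ← Finset.mul_sum,
    sum_drift hN]
  ring

/-- A Nash-type inequality: the energy is controlled by its dissipation, uniformly in `N`. -/
lemma energy_sq_le (h : IsUniformFlow N x p) (hN : 0 < N) (hx : ∀ k, 0 < x k) {t : ℝ}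
    (ht : 0 ≤ t) : energy N x p t ^ 2 ≤ 2 * ∑ k ∈ Finset.range N, drift N x p k t ^ 2 := by
  set A := (∑ i ∈ Finset.range N, x i * p i t) / N
  have h1 : energy N x p t =
      ∑ k ∈ Finset.range N, -drift N x p k t * (p k t - eqConst N x * (x k)⁻¹) := by
    have h2 : ∀ k ∈ Finset.range N, x k * (p k t - eqConst N x * (x k)⁻¹) ^ 2 =
        (A - eqConst N x) * (p k t - eqConst N x * (x k)⁻¹)
          + -drift N x p k t * (p k t - eqConst N x * (x k)⁻¹) := by
      intro k _
      have h3 : x k * (p k t - eqConst N x * (x k)⁻¹) = A - drift N x p k t - eqConst N x := by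
        rw [drift, mul_sub, mul_left_comm, mul_inv_cancel₀ (hx k).ne']
        ring
      linear_combination (p k t - eqConst N x * (x k)⁻¹) * h3
    rw [energy, Finset.sum_congr rfl h2, Finset.sum_add_distrib, ← Finset.mul_sum,
      h.sum_deviation hN hx ht]
    ring
  have h4 : ∑ k ∈ Finset.range N, (p k t - eqConst N x * (x k)⁻¹) ^ 2 ≤ 2 := by
    have h5 : ∀ k ∈ Finset.range N, (p k t - eqConst N x * (x k)⁻¹) ^ 2
        ≤ p k t + eqConst N x * (x k)⁻¹ := by
      intro k hk
      have hp0 : ∀ i ∈ Finset.range N, 0 ≤ p i t := fun i _ => h.nonneg i t ht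
      have hq0 : ∀ i ∈ Finset.range N, 0 ≤ eqConst N x * (x i)⁻¹ := fun i _ =>
        mul_nonneg (eqConst_nonneg hx) (inv_pos.2 (hx i)).le
      have a1 := Finset.single_le_sum hp0 hk
      have a2 := Finset.single_le_sum hq0 hk
      rw [h.sum_eq_one t ht] at a1
      rw [sum_eqConst hN hx] at a2
      nlinarith [hp0 k hk, hq0 k hk, mul_nonneg (hp0 k hk) (hq0 k hk)]
    refine (Finset.sum_le_sum h5).trans ?_
    rw [Finset.sum_add_distrib, h.sum_eq_one t ht, sum_eqConst hN hx]
    norm_num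
  calc energy N x p t ^ 2
      ≤ (∑ k ∈ Finset.range N, (-drift N x p k t) ^ 2) *
          ∑ k ∈ Finset.range N, (p k t - eqConst N x * (x k)⁻¹) ^ 2 := by
        rw [h1]; exact Finset.sum_mul_sq_le_sq_mul_sq _ _ _
    _ ≤ (∑ k ∈ Finset.range N, (-drift N x p k t) ^ 2) * 2 := by
        gcongr
    _ = _ := by simp only [neg_sq]; ring

/-- The spectral gap is at least the smallest rate. -/
lemma gap_mul_energy_le (h : IsUniformFlow N x p) (hN : 0 < N) (hx : ∀ k, 0 < x k)
    (hmin : ∀ k, x 0 ≤ x k) {t : ℝ} (ht : 0 ≤ t) :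
    x 0 * energy N x p t ≤ ∑ k ∈ Finset.range N, drift N x p k t ^ 2 := by
  set A := (∑ i ∈ Finset.range N, x i * p i t) / N
  have h3 : ∀ k, drift N x p k t = (A - eqConst N x) - x k * (p k t - eqConst N x * (x k)⁻¹) := by
    intro k
    rw [drift, mul_sub, mul_left_comm (x k), mul_inv_cancel₀ (hx k).ne']
    ring
  have h1 : energy N x p t ≤ ∑ k ∈ Finset.range N, (x k)⁻¹ * drift N x p k t ^ 2 := by
    have h2 : ∀ k ∈ Finset.range N, (x k)⁻¹ * drift N x p k t ^ 2 =
        (A - eqConst N x) ^ 2 * (x k)⁻¹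
          + (-2 * (A - eqConst N x)) * (p k t - eqConst N x * (x k)⁻¹)
          + x k * (p k t - eqConst N x * (x k)⁻¹) ^ 2 := by
      intro k _
      rw [h3]
      have := (hx k).ne'
      field_simp
      ring
    rw [Finset.sum_congr rfl h2, Finset.sum_add_distrib, Finset.sum_add_distrib, ← Finset.mul_sum,
      ← Finset.mul_sum, h.sum_deviation hN hx ht, ← energy]
    have : 0 ≤ ∑ k ∈ Finset.range N, (x k)⁻¹ :=
      Finset.sum_nonneg fun i _ => (inv_pos.2 (hx i)).le
    nlinarith [mul_nonneg (sq_nonneg (A - eqConst N x)) this]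
  refine (mul_le_mul_of_nonneg_left h1 (hx 0).le).trans ?_
  rw [Finset.mul_sum]
  refine Finset.sum_le_sum fun k _ => ?_
  rw [← mul_assoc]
  refine mul_le_of_le_one_left (sq_nonneg _) ?_
  rw [← div_eq_mul_inv]
  exact (div_le_one (hx k)).2 (hmin k)

lemma energy_antitone (h : IsUniformFlow N x p) (hN : 0 < N) (hx : ∀ k, 0 < x k) {s t : ℝ}
    (hs : 0 < s) (hst : s ≤ t) : energy N x p t ≤ energy N x p s :=
  le_of_hasDerivAt_nonpos hst
    (fun r hr => (h.hasDerivAt_energy hN hx (hs.trans_le hr.1)).continuousAt.continuousWithinAt)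
    (fun r hr => h.hasDerivAt_energy hN hx (hs.trans hr.1))
    (fun r _ => by
      have := Finset.sum_nonneg fun k (_ : k ∈ Finset.range N) => sq_nonneg (drift N x p k r)
      linarith)

/-- The energy is finite after a positive time, uniformly in `N`, although it blows up with `N` at
time `0`. -/
lemma energy_le_inv (h : IsUniformFlow N x p) (hN : 0 < N) (hx : ∀ k, 0 < x k) {t : ℝ}
    (ht : 0 < t) : energy N x p t ≤ t⁻¹ := by
  rcases (energy_nonneg (N := N) (p := p) hx t).eq_or_lt with h0 | h0
  · rw [← h0]; positivity
  have hpos : ∀ s, 0 < s → s ≤ t → 0 < energy N x p s := fun s hs hst =>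
    h0.trans_le (h.energy_antitone hN hx hs hst)
  -- by the Nash inequality, `1 / energy` grows at least at unit speed
  have key : ∀ s, 0 < s → s ≤ t → t - s ≤ (energy N x p t)⁻¹ := by
    intro s hs hst
    have hd : ∀ r, s ≤ r → r ≤ t → HasDerivAt (fun r => r - (energy N x p r)⁻¹)
        (1 - -(-2 * ∑ k ∈ Finset.range N, drift N x p k r ^ 2) / energy N x p r ^ 2) r :=
      fun r hr hrt => (hasDerivAt_id r).sub
        ((h.hasDerivAt_energy hN hx (hs.trans_le hr)).inv (hpos r (hs.trans_le hr) hrt).ne')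
    have := le_of_hasDerivAt_nonpos hst
      (fun r hr => (hd r hr.1 hr.2).continuousAt.continuousWithinAt)
      (fun r hr => hd r hr.1.le hr.2.le) (fun r hr => by
        have h1 := h.energy_sq_le hN hx (hs.trans hr.1).le
        have h2 := hpos r (hs.trans hr.1) hr.2.le
        rw [sub_nonpos, le_div_iff₀ (by positivity)]
        linarith)
    have h3 := inv_pos.2 (hpos s hs hst)
    linarith
  have h4 : t ≤ (energy N x p t)⁻¹ := by
    refine le_of_forall_pos_le_add fun ε hε => ?_
    have := key (min ε t) (lt_min hε ht) (min_le_right _ _)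
    linarith [min_le_left ε t]
  rwa [le_inv_comm₀ h0 ht]

lemma energy_le_exp (h : IsUniformFlow N x p) (hN : 0 < N) (hx : ∀ k, 0 < x k)
    (hmin : ∀ k, x 0 ≤ x k) {t : ℝ} (ht : 1 ≤ t) :
    energy N x p t ≤ Real.exp (-(2 * x 0 * (t - 1))) := by
  have hd : ∀ r, 1 ≤ r → HasDerivAt (fun r => Real.exp (2 * x 0 * (r - 1)) * energy N x p r)
      (Real.exp (2 * x 0 * (r - 1)) * (2 * x 0) * energy N x p r + Real.exp (2 * x 0 * (r - 1)) *
        (-2 * ∑ k ∈ Finset.range N, drift N x p k r ^ 2)) r := by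
    intro r hr
    refine HasDerivAt.mul ?_ (h.hasDerivAt_energy hN hx (by linarith))
    simpa using (((hasDerivAt_id r).sub_const 1).const_mul (2 * x 0)).exp
  have := le_of_hasDerivAt_nonpos ht
    (fun r hr => (hd r hr.1).continuousAt.continuousWithinAt)
    (fun r hr => hd r hr.1.le) (fun r hr => by
      have h1 := h.gap_mul_energy_le hN hx hmin (t := r) (by linarith [hr.1])
      have h2 := Real.exp_pos (2 * x 0 * (r - 1))
      nlinarith)
  have h1 := h.energy_le_inv hN hx one_pos
  simp only [sub_self, mul_zero, Real.exp_zero, one_mul] at this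
  rw [Real.exp_neg, ← one_div, le_div_iff₀ (Real.exp_pos _), mul_comm]
  linarith

lemma sq_deviation_le (h : IsUniformFlow N x p) (hN : 0 < N) (hx : ∀ k, 0 < x k)
    (hmin : ∀ k, x 0 ≤ x k) {k : ℕ} (hk : k < N) {t : ℝ} (ht : 1 ≤ t) :
    (p k t - eqConst N x * (x k)⁻¹) ^ 2 ≤ (x k)⁻¹ * Real.exp (-(2 * x 0 * (t - 1))) := by
  have h1 : x k * (p k t - eqConst N x * (x k)⁻¹) ^ 2 ≤ energy N x p t :=
    Finset.single_le_sum (f := fun k => x k * (p k t - eqConst N x * (x k)⁻¹) ^ 2)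
      (fun i _ => mul_nonneg (hx i).le (sq_nonneg _)) (Finset.mem_range.2 hk)
  rw [inv_mul_eq_div, le_div_iff₀ (hx k), mul_comm]
  exact h1.trans (h.energy_le_exp hN hx hmin ht)

/-- Equicontinuity of the flow away from time `0`: optimized over `a`, this is a Hölder bound of
exponent `1/2` that does not depend on `N`. -/
lemma abs_sub_le (h : IsUniformFlow N x p) (hN : 0 < N) (hx : ∀ k, 0 < x k) {k : ℕ} (hk : k < N)
    {s t a : ℝ} (hs : 0 < s) (hst : s ≤ t) (ha : 0 < a) :
    |p k t - p k s| ≤ a * (t - s) / 2 + (4 * a * s)⁻¹ := by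
  have hE : energy N x p s / (4 * a) ≤ (4 * a * s)⁻¹ := by
    rw [div_eq_mul_inv, mul_comm, mul_inv (4 * a)]
    exact mul_le_mul_of_nonneg_left (h.energy_le_inv hN hx hs) (by positivity)
  have hEt : 0 ≤ energy N x p t / (4 * a) := div_nonneg (energy_nonneg hx t) (by positivity)
  have key : ∀ σ : ℝ, |σ| = 1 → σ * (p k t - p k s) ≤ a * (t - s) / 2 + (4 * a * s)⁻¹ := by
    intro σ hσ
    have hd : ∀ r, s ≤ r → HasDerivAt
        (fun r => σ * p k r + energy N x p r / (4 * a) - a / 2 * r)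
        (σ * drift N x p k r + (-2 * ∑ k ∈ Finset.range N, drift N x p k r ^ 2) / (4 * a)
          - a / 2 * 1) r := fun r hr =>
      (((h.hasDerivAt k hk r (hs.trans_le hr)).const_mul σ).add
        ((h.hasDerivAt_energy hN hx (hs.trans_le hr)).div_const _)).sub
        ((hasDerivAt_id r).const_mul _)
    have := le_of_hasDerivAt_nonpos hst
      (fun r hr => (hd r hr.1).continuousAt.continuousWithinAt)
      (fun r hr => hd r hr.1.le) (fun r hr => by
        have h1 : drift N x p k r ^ 2 ≤ ∑ k ∈ Finset.range N, drift N x p k r ^ 2 :=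
          Finset.single_le_sum (f := fun k => drift N x p k r ^ 2)
            (fun i _ => sq_nonneg _) (Finset.mem_range.2 hk)
        have h2 : σ ^ 2 = 1 := by rw [← sq_abs, hσ, one_pow]
        have h4 : σ * drift N x p k r ≤ a / 2 + drift N x p k r ^ 2 / (2 * a) := by
          rw [← sub_le_iff_le_add', le_div_iff₀ (by positivity)]
          nlinarith [sq_nonneg (a - σ * drift N x p k r)]
        have h5 : (-2 * ∑ k ∈ Finset.range N, drift N x p k r ^ 2) / (4 * a)
            ≤ - (drift N x p k r ^ 2 / (2 * a)) := by
          rw [← neg_div, div_le_div_iff₀ (by positivity) (by positivity)]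
          nlinarith
        linarith)
    linarith
  rw [abs_le']
  exact ⟨by simpa using key 1 (by simp), by simpa using key (-1) (by simp)⟩

end IsUniformFlow

end Relaxation

/-! ### Convergence of the flows as the number of sites grows -/

lemma exists_primitive {f : ℝ → ℝ} (hf : ContinuousOn f (Set.Ici 0)) :
    ∃ F : ℝ → ℝ, F 0 = 0 ∧ ContinuousOn F (Set.Ici 0) ∧ ∀ t, 0 < t → HasDerivAt F (f t) t := by
  have hg : Continuous fun t => f (max t 0) :=
    hf.comp_continuous (by fun_prop) (fun t => le_max_right t 0)
  have hF : ∀ t, HasDerivAt (fun u => ∫ s in (0 : ℝ)..u, f (max s 0)) (f (max t 0)) t := fun t =>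
    (hg.integral_hasStrictDerivAt 0 t).hasDerivAt
  refine ⟨fun u => ∫ s in (0 : ℝ)..u, f (max s 0), by simp,
    fun t _ => (hF t).continuousAt.continuousWithinAt, fun t ht => ?_⟩
  simpa [max_eq_left ht.le] using hF t

namespace IsUniformFlow

variable {N M : ℕ} {x : ℕ → ℝ} {p q : ℕ → ℝ → ℝ}

lemma le_one (h : IsUniformFlow N x p) {k : ℕ} (hk : k < N) {t : ℝ} (ht : 0 ≤ t) : p k t ≤ 1 :=
  h.sum_eq_one t ht ▸ Finset.single_le_sum (f := fun k => p k t)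
    (fun i _ => h.nonneg i t ht) (Finset.mem_range.2 hk)

/-- Integrated form of the forward equation: with `W k t` the mean time spent at `k` up to time `t`,
the quantity `p k t + x k * W k t` does not depend on `k`, and it grows at most linearly, uniformly
in `N`. -/
lemma exists_occupation (h : IsUniformFlow N x p) (hN : 0 < N) (hx : ∀ k, 0 < x k) :
    ∃ (W : ℕ → ℝ → ℝ) (C : ℝ → ℝ), (∀ k < N, W k 0 = 0) ∧
      (∀ k < N, ContinuousOn (W k) (Set.Ici 0)) ∧
      (∀ k < N, ∀ t, 0 < t → HasDerivAt (W k) (p k t) t) ∧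
      (∀ k < N, ∀ t, 0 ≤ t → p k t = C t - x k * W k t) ∧ ∀ t, 0 ≤ t → C t ≤ 1 + x 0 * t := by
  have hW : ∀ k, ∃ F : ℝ → ℝ, k < N → F 0 = 0 ∧ ContinuousOn F (Set.Ici 0) ∧
      ∀ t, 0 < t → HasDerivAt F (p k t) t := by
    intro k
    by_cases hk : k < N
    · obtain ⟨F, hF⟩ := exists_primitive (h.continuousOn k hk)
      exact ⟨F, fun _ => hF⟩
    · exact ⟨0, fun h => absurd h hk⟩
  choose W hW using hW
  have hconst : ∀ k < N, ∀ σ : ℝ, ∀ t, 0 ≤ t →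
      σ * (p k t + x k * W k t - (p 0 t + x 0 * W 0 t)) ≤ 0 := by
    intro k hk σ t ht
    have hd : ∀ j < N, ∀ s, 0 < s → HasDerivAt (fun s => p j s + x j * W j s)
        ((∑ i ∈ Finset.range N, x i * p i s) / N) s := fun j hj s hs =>
      ((h.hasDerivAt j hj s hs).add (((hW j hj).2.2 s hs).const_mul (x j))).congr_deriv (by ring)
    have hc : ∀ j < N, ContinuousOn (fun s => p j s + x j * W j s) (Set.Icc 0 t) := fun j hj =>
      ((h.continuousOn j hj).add (continuousOn_const.mul (hW j hj).2.1)).mono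
        Set.Icc_subset_Ici_self
    have := le_of_hasDerivAt_nonpos ht (continuousOn_const.mul ((hc k hk).sub (hc 0 hN)))
      (fun s hs => ((hd k hk s hs.1).sub (hd 0 hN s hs.1)).const_mul σ)
      (fun s _ => by simp)
    simpa [h.initial k hk, h.initial 0 hN, (hW k hk).1, (hW 0 hN).1] using this
  refine ⟨W, fun t => p 0 t + x 0 * W 0 t, fun k hk => (hW k hk).1, fun k hk => (hW k hk).2.1,
    fun k hk => (hW k hk).2.2, fun k hk t ht => ?_, fun t ht => ?_⟩
  · have h1 := hconst k hk 1 t ht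
    have h2 := hconst k hk (-1) t ht
    linarith
  · have h0 : W 0 t - t ≤ W 0 0 - 0 := le_of_hasDerivAt_nonpos ht
      (((hW 0 hN).2.1.mono Set.Icc_subset_Ici_self).sub continuousOn_id)
      (fun s hs => ((hW 0 hN).2.2 s hs.1).sub (hasDerivAt_id s))
      (fun s hs => by linarith [h.le_one hN hs.1.le])
    rw [(hW 0 hN).1, sub_zero, sub_nonpos] at h0
    have := mul_le_mul_of_nonneg_left h0 (hx 0).le
    linarith [h.le_one hN ht]

/-- Comparison of the flows with `N` and `M ≥ N` sites: the square of their difference at a site is,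
integrated over time, at most a constant times the total waiting time of the additional sites. -/
lemma sq_sub_le (hp : IsUniformFlow N x p) (hq : IsUniformFlow M x q) (hN : 0 < N) (hNM : N ≤ M)
    (hx : ∀ k, 0 < x k) {k : ℕ} (hk : k < N) {t T c : ℝ} (ht : 0 ≤ t) (htT : t ≤ T)
    (hc : ∀ s ∈ Set.Ioo t T, c ≤ (q k s - p k s) ^ 2) :
    c * (T - t) ≤ (1 + x 0 * T) ^ 2 * ∑ j ∈ Finset.Ico N M, (x j)⁻¹ := by
  obtain ⟨V, C, hV0, hVc, hVd, hVp, hVC⟩ := hp.exists_occupation hN hx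
  obtain ⟨W, D, hW0, hWc, hWd, hWq, hWD⟩ := hq.exists_occupation (hN.trans_le hNM) hx
  set K := 1 + x 0 * T
  -- `Φ` is the energy of the difference of the integrated flows, extended by `0` beyond `N`
  set Φ : ℝ → ℝ := fun s => ∑ j ∈ Finset.range N, x j / 2 * (W j s - V j s) ^ 2 +
    ∑ j ∈ Finset.Ico N M, x j / 2 * W j s ^ 2
  set Ψ : ℝ → ℝ := fun s => Φ s - K * ∑ j ∈ Finset.Ico N M, W j s
  have hrN : ∀ j ∈ Finset.range N, j < N ∧ j < M := fun j hj =>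
    ⟨Finset.mem_range.1 hj, (Finset.mem_range.1 hj).trans_le hNM⟩
  have hΨc : ContinuousOn Ψ (Set.Ici 0) := by
    refine ContinuousOn.sub (ContinuousOn.add ?_ ?_) (continuousOn_const.mul ?_)
    · exact continuousOn_finsetSum _ fun j hj => continuousOn_const.mul
        (((hWc j (hrN j hj).2).sub (hVc j (hrN j hj).1)).pow 2)
    · exact continuousOn_finsetSum _ fun j hj => continuousOn_const.mul
        ((hWc j (Finset.mem_Ico.1 hj).2).pow 2)
    · exact continuousOn_finsetSum _ fun j hj => hWc j (Finset.mem_Ico.1 hj).2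
  set Ψ' : ℝ → ℝ := fun s => ∑ j ∈ Finset.range N, x j * (W j s - V j s) * (q j s - p j s) +
    ∑ j ∈ Finset.Ico N M, x j * W j s * q j s - K * ∑ j ∈ Finset.Ico N M, q j s
  have hΨd : ∀ s, 0 < s → HasDerivAt Ψ (Ψ' s) s := by
    intro s hs
    refine HasDerivAt.sub (HasDerivAt.add ?_ ?_) (HasDerivAt.const_mul _ ?_)
    · refine HasDerivAt.fun_sum fun j hj => ?_
      refine ((((hWd j (hrN j hj).2 s hs).sub (hVd j (hrN j hj).1 s hs)).fun_pow 2).const_mul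
        (x j / 2)).congr_deriv ?_
      simp
      ring
    · refine HasDerivAt.fun_sum fun j hj => ?_
      refine (((hWd j (Finset.mem_Ico.1 hj).2 s hs).fun_pow 2).const_mul (x j / 2)).congr_deriv ?_
      simp
      ring
    · exact HasDerivAt.fun_sum fun j hj => hWd j (Finset.mem_Ico.1 hj).2 s hs
  have hΨ' : ∀ s, 0 < s → s ≤ T → Ψ' s ≤ -(q k s - p k s) ^ 2 := by
    intro s hs hsT
    have hs0 := hs.le
    have e1 : ∑ j ∈ Finset.range N, x j * (W j s - V j s) * (q j s - p j s) =
        (D s - C s) * ∑ j ∈ Finset.range N, (q j s - p j s)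
          - ∑ j ∈ Finset.range N, (q j s - p j s) ^ 2 := by
      rw [Finset.mul_sum, ← Finset.sum_sub_distrib]
      refine Finset.sum_congr rfl fun j hj => ?_
      linear_combination (q j s - p j s) *
        (hWq j (hrN j hj).2 s hs0 - hVp j (hrN j hj).1 s hs0)
    have e2 : ∑ j ∈ Finset.Ico N M, x j * W j s * q j s =
        D s * ∑ j ∈ Finset.Ico N M, q j s - ∑ j ∈ Finset.Ico N M, q j s ^ 2 := by
      rw [Finset.mul_sum, ← Finset.sum_sub_distrib]
      refine Finset.sum_congr rfl fun j hj => ?_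
      linear_combination q j s * hWq j (Finset.mem_Ico.1 hj).2 s hs0
    have e3 : ∑ j ∈ Finset.range N, (q j s - p j s) = - ∑ j ∈ Finset.Ico N M, q j s := by
      have := Finset.sum_range_add_sum_Ico (fun j => q j s) hNM
      rw [hq.sum_eq_one s hs0] at this
      rw [Finset.sum_sub_distrib, hp.sum_eq_one s hs0]
      linarith
    have e4 : 0 ≤ ∑ j ∈ Finset.Ico N M, q j s := Finset.sum_nonneg fun j _ => hq.nonneg j s hs0
    have e5 : 0 ≤ ∑ j ∈ Finset.Ico N M, q j s ^ 2 := Finset.sum_nonneg fun j _ => sq_nonneg _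
    have e6 : (q k s - p k s) ^ 2 ≤ ∑ j ∈ Finset.range N, (q j s - p j s) ^ 2 :=
      Finset.single_le_sum (f := fun j => (q j s - p j s) ^ 2) (fun i _ => sq_nonneg _)
        (Finset.mem_range.2 hk)
    have e7 : C s ≤ K := (hVC s hs0).trans
      (by simpa [K] using mul_le_mul_of_nonneg_left hsT (hx 0).le)
    have e8 : Ψ' s = (C s - K) * ∑ j ∈ Finset.Ico N M, q j s
        - ∑ j ∈ Finset.range N, (q j s - p j s) ^ 2 - ∑ j ∈ Finset.Ico N M, q j s ^ 2 := by
      simp only [Ψ']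
      rw [e1, e2, e3]
      ring
    nlinarith
  have a1 : Ψ t ≤ Ψ 0 := le_of_hasDerivAt_nonpos ht (hΨc.mono Set.Icc_subset_Ici_self)
    (fun s hs => hΨd s hs.1)
    (fun s hs => (hΨ' s hs.1 (hs.2.le.trans htT)).trans (neg_nonpos.2 (sq_nonneg _)))
  have a2 : Ψ T + c * T ≤ Ψ t + c * t := le_of_hasDerivAt_nonpos htT
    ((hΨc.mono fun s hs => ht.trans hs.1).add (continuousOn_const.mul continuousOn_id))
    (fun s hs => (hΨd s (ht.trans_lt hs.1)).add ((hasDerivAt_id s).const_mul c))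
    (fun s hs => by
      have := hΨ' s (ht.trans_lt hs.1) hs.2.le
      have := hc s hs
      linarith)
  have hT : 0 ≤ T := ht.trans htT
  have a3 : Ψ 0 = 0 := by
    have b1 : ∑ j ∈ Finset.range N, x j / 2 * (W j 0 - V j 0) ^ 2 = 0 :=
      Finset.sum_eq_zero fun j hj => by simp [hW0 j (hrN j hj).2, hV0 j (hrN j hj).1]
    have b2 : ∑ j ∈ Finset.Ico N M, x j / 2 * W j 0 ^ 2 = 0 :=
      Finset.sum_eq_zero fun j hj => by simp [hW0 j (Finset.mem_Ico.1 hj).2]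
    have b3 : ∑ j ∈ Finset.Ico N M, W j 0 = 0 :=
      Finset.sum_eq_zero fun j hj => hW0 j (Finset.mem_Ico.1 hj).2
    simp only [Ψ, Φ]
    rw [b1, b2, b3]
    simp
  have a4 : 0 ≤ Φ T := add_nonneg
    (Finset.sum_nonneg fun j _ => mul_nonneg (half_pos (hx j)).le (sq_nonneg _))
    (Finset.sum_nonneg fun j _ => mul_nonneg (half_pos (hx j)).le (sq_nonneg _))
  have a5 : ∑ j ∈ Finset.Ico N M, W j T ≤ K * ∑ j ∈ Finset.Ico N M, (x j)⁻¹ := by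
    rw [Finset.mul_sum]
    refine Finset.sum_le_sum fun j hj => ?_
    rw [← div_eq_mul_inv, le_div_iff₀ (hx j)]
    have := hWq j (Finset.mem_Ico.1 hj).2 T hT
    have := hq.nonneg j T hT
    have := hWD T hT
    linarith
  have hK : 0 ≤ K := add_nonneg zero_le_one (mul_nonneg (hx 0).le hT)
  have a6 := mul_le_mul_of_nonneg_left a5 hK
  have a7 : Ψ T = Φ T - K * ∑ j ∈ Finset.Ico N M, W j T := rfl
  nlinarith

end IsUniformFlow

section Limit

variable {x : ℕ → ℝ} {p : ℕ → ℕ → ℝ → ℝ}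

lemma cauchySeq_flow (hp : ∀ N, 2 ≤ N → IsUniformFlow N x (p N)) (hx : ∀ k, 0 < x k)
    (hs : Summable fun k => (x k)⁻¹) (k : ℕ) {t : ℝ} (ht : 0 < t) :
    CauchySeq fun N => p N k t := by
  refine Metric.cauchySeq_iff'.2 fun ε hε => ?_
  -- with this choice of `a` and `δ`, each flow moves by at most `ε / 4` on `[t, t + δ]`
  set a : ℝ := 2 / (t * ε)
  have ha : 0 < a := by positivity
  set δ : ℝ := ε / (4 * a)
  have hδ : 0 < δ := by positivity
  have hmove : ∀ N, 2 ≤ N → k < N → ∀ s ∈ Set.Ioo t (t + δ), |p N k s - p N k t| ≤ ε / 4 := by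
    intro N hN hk s hst
    refine ((hp N hN).abs_sub_le (by omega) hx hk ht hst.1.le ha).trans ?_
    have h1 : a * (s - t) ≤ ε / 4 := by
      calc a * (s - t) ≤ a * δ := by gcongr; linarith [hst.2]
        _ = ε / 4 := by simp only [δ]; field_simp
    have h2 : (4 * a * t)⁻¹ = ε / 8 := by simp only [a]; field_simp; norm_num
    linarith
  set K := 1 + x 0 * (t + δ)
  have hK : 0 < K := add_pos_of_pos_of_nonneg one_pos (mul_nonneg (hx 0).le (by linarith))
  have hη : 0 < (ε / 2) ^ 2 * δ / K ^ 2 := by positivity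
  obtain ⟨N₀, hN₀⟩ := Metric.cauchySeq_iff'.1 hs.hasSum.tendsto_sum_nat.cauchySeq _ hη
  set N := max N₀ (max 2 (k + 1))
  have hN2 : 2 ≤ N := (le_max_left _ _).trans (le_max_right _ _)
  have hNk : k < N := (le_max_right _ _).trans (le_max_right N₀ (max 2 (k + 1)))
  refine ⟨N, fun M hM => ?_⟩
  by_contra! hcon
  rw [Real.dist_eq] at hcon
  have h1 := (hp N hN2).sq_sub_le (hp M (hN2.trans hM)) (by omega) hM hx hNk ht.le
    (le_add_of_nonneg_right hδ.le) (c := (ε / 2) ^ 2) (fun s hst => by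
      have b1 := hmove N hN2 hNk s hst
      have b2 := hmove M (hN2.trans hM) (hNk.trans_le hM) s hst
      rw [← sq_abs (p M k s - p N k s)]
      refine pow_le_pow_left₀ (by positivity) ?_ 2
      have b3 : |p M k t - p N k t| ≤ |p M k s - p N k s| + |p M k s - p M k t|
          + |p N k s - p N k t| := by
        have : p M k t - p N k t = (p M k s - p N k s) - (p M k s - p M k t)
          + (p N k s - p N k t) := by ring
        rw [this]
        exact (abs_add_le _ _).trans (add_le_add_left (abs_sub _ _) _)
      linarith)
  have h2 : ∑ j ∈ Finset.Ico N M, (x j)⁻¹ < (ε / 2) ^ 2 * δ / K ^ 2 := by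
    refine lt_of_le_of_lt ?_ (hN₀ M ((le_max_left _ _).trans hM))
    rw [Real.dist_eq]
    refine le_trans ?_ (le_abs_self _)
    rw [← Finset.sum_Ico_eq_sub _ ((le_max_left _ _).trans hM)]
    exact Finset.sum_le_sum_of_subset_of_nonneg
      (Finset.Ico_subset_Ico_left (le_max_left _ _)) fun i _ _ => (inv_pos.2 (hx i)).le
  rw [lt_div_iff₀ (by positivity)] at h2
  rw [add_sub_cancel_left] at h1
  linarith

/-- The limiting mass of site `k` at time `t` as the number of sites tends to infinity. The limit
exists for `t > 0`; no other values are used. -/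
noncomputable def limitFlow (p : ℕ → ℕ → ℝ → ℝ) (k : ℕ) (t : ℝ) : ℝ :=
  limUnder atTop fun N => p N k t

lemma tendsto_limitFlow (hp : ∀ N, 2 ≤ N → IsUniformFlow N x (p N)) (hx : ∀ k, 0 < x k)
    (hs : Summable fun k => (x k)⁻¹) (k : ℕ) {t : ℝ} (ht : 0 < t) :
    Tendsto (fun N => p N k t) atTop (𝓝 (limitFlow p k t)) :=
  (cauchySeq_flow hp hx hs k ht).tendsto_limUnder

lemma limitFlow_mem_Icc (hp : ∀ N, 2 ≤ N → IsUniformFlow N x (p N)) (hx : ∀ k, 0 < x k)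
    (hs : Summable fun k => (x k)⁻¹) (k : ℕ) {t : ℝ} (ht : 0 < t) :
    limitFlow p k t ∈ Set.Icc 0 1 := by
  refine isClosed_Icc.mem_of_tendsto (tendsto_limitFlow hp hx hs k ht) ?_
  filter_upwards [eventually_ge_atTop 2, eventually_gt_atTop k] with N hN hk
  exact ⟨(hp N hN).nonneg k t ht.le, (hp N hN).le_one hk ht.le⟩

/-- Since the rate of relaxation does not depend on `N`, the limiting flow relaxes too. -/
lemma tendsto_limitFlow_atTop (hp : ∀ N, 2 ≤ N → IsUniformFlow N x (p N)) (hx : ∀ k, 0 < x k)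
    (hmin : ∀ k, x 0 ≤ x k) (hs : Summable fun k => (x k)⁻¹) (k : ℕ) :
    Tendsto (limitFlow p k) atTop (𝓝 ((x k)⁻¹ / ∑' i, (x i)⁻¹)) := by
  have hS : 0 < ∑' i, (x i)⁻¹ := hs.tsum_pos (fun i => (inv_pos.2 (hx i)).le) 0 (inv_pos.2 (hx 0))
  have heq : Tendsto (fun N => eqConst N x * (x k)⁻¹) atTop (𝓝 ((x k)⁻¹ / ∑' i, (x i)⁻¹)) := by
    rw [div_eq_inv_mul]
    exact (hs.hasSum.tendsto_sum_nat.inv₀ hS.ne').mul_const _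
  have hsq : ∀ t, 1 ≤ t → (limitFlow p k t - (x k)⁻¹ / ∑' i, (x i)⁻¹) ^ 2
      ≤ (x k)⁻¹ * Real.exp (-(2 * x 0 * (t - 1))) := by
    intro t ht
    refine le_of_tendsto (((tendsto_limitFlow hp hx hs k (by linarith)).sub heq).pow 2) ?_
    filter_upwards [eventually_ge_atTop 2, eventually_gt_atTop k] with N hN hk
    exact (hp N hN).sq_deviation_le (by omega) hx hmin hk ht
  have hexp : Tendsto (fun t : ℝ => (x k)⁻¹ * Real.exp (-(2 * x 0 * (t - 1)))) atTop (𝓝 0) := by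
    rw [← mul_zero (x k)⁻¹]
    refine (Real.tendsto_exp_neg_atTop_nhds_zero.comp ?_).const_mul _
    exact (tendsto_atTop_add_const_right _ (-1) tendsto_id).const_mul_atTop
      (mul_pos two_pos (hx 0))
  have h0 : Tendsto (fun t => (limitFlow p k t - (x k)⁻¹ / ∑' i, (x i)⁻¹) ^ 2) atTop (𝓝 0) :=
    squeeze_zero' (.of_forall fun t => sq_nonneg _)
      ((eventually_ge_atTop 1).mono hsq) hexp
  have h1 : Tendsto (fun t => limitFlow p k t - (x k)⁻¹ / ∑' i, (x i)⁻¹) atTop (𝓝 0) := by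
    rw [tendsto_zero_iff_abs_tendsto_zero]
    simpa [Function.comp_def, Real.sqrt_sq_eq_abs] using h0.sqrt
  simpa using h1.add_const ((x k)⁻¹ / ∑' i, (x i)⁻¹)

lemma exp_neg_mul_le {r t : ℝ} (hr : 0 < r) (ht : 0 < t) : Real.exp (-(r * t)) ≤ r⁻¹ * t⁻¹ := by
  rw [Real.exp_neg, ← mul_inv]
  exact inv_anti₀ (by positivity) ((le_add_of_nonneg_right zero_le_one).trans
    (Real.add_one_le_exp _))

/-- The probability not to jump during `[s, s + t]`, in the limit of infinitely many sites. -/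
lemma tendsto_sum_flow_mul_exp (hp : ∀ N, 2 ≤ N → IsUniformFlow N x (p N)) (hx : ∀ k, 0 < x k)
    (hs : Summable fun k => (x k)⁻¹) {s t : ℝ} (h0s : 0 < s) (ht : 0 < t) :
    Tendsto (fun N : ℕ => ∑ k ∈ Finset.range N,
      p N k s * Real.exp (-(x k * (((N : ℝ) - 1) / N) * t))) atTop
      (𝓝 (∑' k, limitFlow p k s * Real.exp (-(x k * t)))) := by
  have hlim : Tendsto (fun N : ℕ => ((N : ℝ) - 1) / N) atTop (𝓝 1) := by
    have h1 : Tendsto (fun N : ℕ => 1 - (N : ℝ)⁻¹) atTop (𝓝 (1 - 0)) :=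
      tendsto_const_nhds.sub tendsto_inv_atTop_nhds_zero_nat
    rw [sub_zero] at h1
    refine h1.congr' ?_
    filter_upwards [eventually_gt_atTop 0] with N hN
    have : (N : ℝ) ≠ 0 := by positivity
    field_simp
  have key := tendsto_tsum_of_dominated_convergence (𝓕 := atTop)
    (f := fun (N : ℕ) k => if k < N then
      p N k s * Real.exp (-(x k * (((N : ℝ) - 1) / N) * t)) else 0)
    (g := fun k => limitFlow p k s * Real.exp (-(x k * t)))
    (bound := fun k => (x k)⁻¹ * (t / 2)⁻¹) (hs.mul_right _) ?_ ?_
  · refine key.congr fun N => ?_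
    rw [tsum_eq_sum (s := Finset.range N) (fun k hk => if_neg (by simpa using hk))]
    exact Finset.sum_congr rfl fun k hk => if_pos (by simpa using hk)
  · intro k
    have h1 : Tendsto (fun N : ℕ => p N k s * Real.exp (-(x k * (((N : ℝ) - 1) / N) * t))) atTop
        (𝓝 (limitFlow p k s * Real.exp (-(x k * 1 * t)))) :=
      (tendsto_limitFlow hp hx hs k h0s).mul
        ((Real.continuous_exp.tendsto _).comp ((hlim.const_mul (x k)).mul_const t).neg)
    rw [mul_one] at h1
    refine h1.congr' ?_
    filter_upwards [eventually_gt_atTop k] with N hN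
    rw [if_pos hN]
  · filter_upwards [eventually_ge_atTop 2] with N hN k
    have hb : 0 ≤ (x k)⁻¹ * (t / 2)⁻¹ := by have := hx k; positivity
    split_ifs with hk
    · have hN' : (2 : ℝ) ≤ N := by exact_mod_cast hN
      have h2 : Real.exp (-(x k * (((N : ℝ) - 1) / N) * t)) ≤ (x k)⁻¹ * (t / 2)⁻¹ := by
        refine le_trans (Real.exp_le_exp.2 (neg_le_neg ?_)) (exp_neg_mul_le (hx k) (half_pos ht))
        have h3 : 1 / 2 ≤ ((N : ℝ) - 1) / N := by
          rw [div_le_div_iff₀ (by norm_num) (by linarith)]; linarith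
        have := mul_le_mul_of_nonneg_left h3 (mul_pos (hx k) ht).le
        linarith
      rw [Real.norm_of_nonneg (mul_nonneg ((hp N hN).nonneg k s h0s.le) (Real.exp_pos _).le)]
      exact (mul_le_of_le_one_left (Real.exp_pos _).le ((hp N hN).le_one hk h0s.le)).trans h2
    · simpa using hb

lemma tendsto_tsum_limitFlow (hp : ∀ N, 2 ≤ N → IsUniformFlow N x (p N)) (hx : ∀ k, 0 < x k)
    (hmin : ∀ k, x 0 ≤ x k) (hs : Summable fun k => (x k)⁻¹) {t : ℝ} (ht : 0 < t) :
    Tendsto (fun s => ∑' k, limitFlow p k s * Real.exp (-(x k * t))) atTop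
      (𝓝 ((∑' k, (x k)⁻¹ * Real.exp (-(x k * t))) / ∑' k, (x k)⁻¹)) := by
  rw [← tsum_div_const]
  refine tendsto_tsum_of_dominated_convergence (bound := fun k => (x k)⁻¹ * t⁻¹)
    (hs.mul_right _) (fun k => ?_) ?_
  · rw [mul_div_right_comm]
    exact (tendsto_limitFlow_atTop hp hx hmin hs k).mul_const _
  · filter_upwards [eventually_gt_atTop 0] with s h0s k
    have h1 := limitFlow_mem_Icc hp hx hs k h0s
    rw [Real.norm_of_nonneg (mul_nonneg h1.1 (Real.exp_pos _).le)]
    exact (mul_le_of_le_one_left (Real.exp_pos _).le h1.2).trans (exp_neg_mul_le (hx k) ht)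

lemma tendsto_tsum_limitFlow_mul (hp : ∀ N, 2 ≤ N → IsUniformFlow N x (p N)) (hx : ∀ k, 0 < x k)
    (hs : Summable fun k => (x k)⁻¹) {θ : ℝ} (hθ : 0 < θ) :
    Tendsto (fun s => ∑' k, limitFlow p k s * Real.exp (-(x k * (θ * s)))) atTop (𝓝 0) := by
  rw [← tsum_zero (β := ℕ)]
  have hle : ∀ s, 0 < s → ∀ k, ‖limitFlow p k s * Real.exp (-(x k * (θ * s)))‖
      ≤ (x k)⁻¹ * (θ * s)⁻¹ := by
    intro s h0s k
    have h1 := limitFlow_mem_Icc hp hx hs k h0s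
    rw [Real.norm_of_nonneg (mul_nonneg h1.1 (Real.exp_pos _).le)]
    exact (mul_le_of_le_one_left (Real.exp_pos _).le h1.2).trans
      (exp_neg_mul_le (hx k) (mul_pos hθ h0s))
  refine tendsto_tsum_of_dominated_convergence (bound := fun k => (x k)⁻¹ * θ⁻¹)
    (hs.mul_right _) (fun k => ?_) ?_
  · refine squeeze_zero_norm' ((eventually_gt_atTop 0).mono fun s h0s => hle s h0s k) ?_
    rw [← mul_zero (x k)⁻¹]
    exact (tendsto_inv_atTop_zero.comp (tendsto_id.const_mul_atTop hθ)).const_mul _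
  · filter_upwards [eventually_ge_atTop 1] with s h1s k
    refine (hle s (by linarith) k).trans ?_
    have := (inv_pos.2 (hx k)).le
    gcongr
    exact le_mul_of_one_le_right hθ.le h1s

end Limit

/-! ### The sequence of visited sites -/

lemma uniformLaw_apply {s : Finset ℕ} (hs : s.Nonempty) (d k : ℕ) :
    uniformLaw s d k = if k ∈ s then (s.card : ℝ≥0∞)⁻¹ else 0 := by
  rw [uniformLaw, dif_pos hs, PMF.uniformOfFinset_apply]
  congr

lemma jumpKernel_apply {N i : ℕ} (hN : 2 ≤ N) (hi : i < N) (k : ℕ) :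
    jumpKernel N i {k} = if k < N ∧ k ≠ i then ((N - 1 : ℕ) : ℝ≥0∞)⁻¹ else 0 := by
  have hcard : ((Finset.range N).erase i).card = N - 1 := by
    rw [Finset.card_erase_of_mem (Finset.mem_range.2 hi), Finset.card_range]
  have hne : ((Finset.range N).erase i).Nonempty := by
    rw [← Finset.card_pos, hcard]; omega
  change (uniformLaw ((Finset.range N).erase i) i).toMeasure {k} = _
  rw [PMF.toMeasure_apply_singleton _ _ (measurableSet_singleton k), uniformLaw_apply hne, hcard]
  simp [and_comm]

instance (N : ℕ) : IsProbabilityMeasure (uniformLaw (Finset.range N) 0).toMeasure :=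
  PMF.toMeasure.isProbabilityMeasure _

instance (N : ℕ) : IsProbabilityMeasure (skeletonLaw N) := by
  unfold skeletonLaw; infer_instance

instance : IsProbabilityMeasure (expMeasure 1) := isProbabilityMeasure_expMeasure one_pos

instance (N : ℕ) : IsProbabilityMeasure (walkMeasure N) := by
  unfold walkMeasure; infer_instance

lemma skeletonLaw_zero {N k : ℕ} (hk : k < N) :
    skeletonLaw N {X | X 0 = k} = (N : ℝ≥0∞)⁻¹ := by
  have h1 : (skeletonLaw N).map (Preorder.frestrictLe (π := fun _ => ℕ) 0) =
      (uniformLaw (Finset.range N) 0).toMeasure.map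
        (MeasurableEquiv.piUnique (fun _ : Finset.Iic 0 => ℕ)).symm := by
    rw [skeletonLaw, Kernel.trajMeasure, Measure.map_comp _ _ (by fun_prop),
      Kernel.traj_map_frestrictLe, Kernel.partialTraj_self, Measure.id_comp]
  have h2 : {X : ℕ → ℕ | X 0 = k} = Preorder.frestrictLe (π := fun _ => ℕ) 0 ⁻¹'
      {h | h ⟨0, Finset.mem_Iic.2 le_rfl⟩ = k} := rfl
  have hm : MeasurableSet {h : Finset.Iic 0 → ℕ | h ⟨0, Finset.mem_Iic.2 le_rfl⟩ = k} :=
    measurableSet_eq_fun (measurable_pi_apply _) measurable_const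
  rw [h2, ← Measure.map_apply (by fun_prop) hm, h1, Measure.map_apply (by fun_prop) hm]
  have h3 : (MeasurableEquiv.piUnique (fun _ : Finset.Iic 0 => ℕ)).symm ⁻¹'
      {h : Finset.Iic 0 → ℕ | h ⟨0, Finset.mem_Iic.2 le_rfl⟩ = k} = {k} := by
    ext j
    simp only [Set.mem_preimage, Set.mem_ofPred_eq, Set.mem_singleton_iff]
    exact Iff.rfl
  rw [h3, PMF.toMeasure_apply_singleton _ _ (measurableSet_singleton k),
    uniformLaw_apply ⟨k, Finset.mem_range.2 hk⟩, if_pos (Finset.mem_range.2 hk), Finset.card_range]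

/-- Markov property of the sequence of visited sites. -/
lemma skeletonLaw_step (N n i k : ℕ) {A : Set (ℕ → ℕ)} (hA : MeasurableSet A)
    (hAn : ∀ X X' : ℕ → ℕ, (∀ j ≤ n, X j = X' j) → X ∈ A → X' ∈ A) :
    skeletonLaw N {X | X ∈ A ∧ X n = i ∧ X (n + 1) = k} =
      jumpKernel N i {k} * skeletonLaw N {X | X ∈ A ∧ X n = i} := by
  set extend : (Finset.Iic n → ℕ) → ℕ → ℕ :=
    fun h j => if hj : j ≤ n then h ⟨j, Finset.mem_Iic.2 hj⟩ else 0
  have hext : Measurable extend := by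
    refine measurable_pi_lambda _ fun j => ?_
    by_cases hj : j ≤ n
    · simpa only [extend, dif_pos hj] using measurable_pi_apply _
    · simp only [extend, dif_neg hj, measurable_const]
  set B : Set (Finset.Iic n → ℕ) := {h | extend h ∈ A ∧ h ⟨n, Finset.mem_Iic.2 le_rfl⟩ = i}
  have hB : MeasurableSet B :=
    (hext hA).inter (measurableSet_eq_fun (measurable_pi_apply _) measurable_const)
  have hpre : ∀ X : ℕ → ℕ, Preorder.frestrictLe (π := fun _ => ℕ) n X ∈ B ↔ X ∈ A ∧ X n = i := by
    intro X
    have hX : ∀ j ≤ n, extend (Preorder.frestrictLe (π := fun _ => ℕ) n X) j = X j := by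
      intro j hj
      simp only [extend, dif_pos hj]
      rfl
    exact and_congr ⟨hAn _ _ hX, hAn _ _ fun j hj => (hX j hj).symm⟩ Iff.rfl
  have key := Kernel.map_frestrictLe_trajMeasure_compProd_eq_map_trajMeasure
    (X := fun _ => ℕ) (μ₀ := (uniformLaw (Finset.range N) 0).toMeasure)
    (κ := fun n => (jumpKernel N).comap
      (fun h : (Finset.Iic n → ℕ) => h ⟨n, Finset.mem_Iic.2 le_rfl⟩) (measurable_pi_apply _))
    (a := n)
  have key2 := congrArg (fun m => m (B ×ˢ {k})) key
  rw [Measure.compProd_apply_prod hB (measurableSet_singleton k),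
    Measure.map_apply (by fun_prop) (hB.prod (measurableSet_singleton k))] at key2
  have h1 : (fun x : ℕ → ℕ => (Preorder.frestrictLe (π := fun _ => ℕ) n x, x (n + 1))) ⁻¹'
      (B ×ˢ {k}) = {X | X ∈ A ∧ X n = i ∧ X (n + 1) = k} := by
    ext X
    simp only [Set.mem_preimage, Set.mem_prod, hpre, Set.mem_singleton_iff, Set.mem_ofPred_eq,
      and_assoc]
  rw [h1] at key2
  change _ = skeletonLaw N _ at key2
  rw [← key2]
  have h2 : ∀ h ∈ B, ((jumpKernel N).comap
      (fun h : (Finset.Iic n → ℕ) => h ⟨n, Finset.mem_Iic.2 le_rfl⟩) (measurable_pi_apply _)) h {k}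
        = jumpKernel N i {k} := by
    intro h hh
    rw [Kernel.comap_apply, hh.2]
  rw [setLIntegral_congr_fun hB h2, setLIntegral_const, Measure.map_apply (by fun_prop) hB]
  congr 2
  ext X
  exact hpre X

lemma skeletonLaw_ae {N : ℕ} (hN : 2 ≤ N) :
    ∀ᵐ X ∂skeletonLaw N, ∀ n, X n < N ∧ X (n + 1) ≠ X n := by
  have hlt : ∀ n, ∀ᵐ X ∂skeletonLaw N, X n < N := by
    intro n
    induction n with
    | zero =>
      have hu : skeletonLaw N (⋃ k ∈ Finset.range N, {X : ℕ → ℕ | X 0 = k}) = 1 := by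
        rw [measure_biUnion_finset]
        · rw [Finset.sum_congr rfl fun k hk => skeletonLaw_zero (Finset.mem_range.1 hk)]
          simp only [Finset.sum_const, Finset.card_range, nsmul_eq_mul]
          exact ENNReal.mul_inv_cancel (by simp; omega) (by simp)
        · intro a _ b _ hab
          exact Set.disjoint_left.2 fun X hX hX' => hab (hX.symm.trans hX')
        · exact fun k _ => measurableSet_eq_fun (measurable_pi_apply _) measurable_const
      have := (prob_compl_eq_zero_iff (MeasurableSet.biUnion (Finset.countable_toSet _)
        fun k _ => measurableSet_eq_fun (measurable_pi_apply 0) measurable_const)).2 hu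
      refine mem_of_superset (compl_mem_ae_iff.2 this) ?_
      intro X hX
      simpa using hX
    | succ n ih =>
      have h0 : ∀ i k, i < N → ¬ k < N → ∀ᵐ X ∂skeletonLaw N, ¬ (X n = i ∧ X (n + 1) = k) := by
        intro i k hi hk
        have := skeletonLaw_step N n i k MeasurableSet.univ (fun _ _ _ _ => trivial)
        rw [jumpKernel_apply hN hi, if_neg (fun h => hk h.1), zero_mul] at this
        rw [ae_iff]
        simpa using this
      have h1 : ∀ᵐ X ∂skeletonLaw N, ∀ i k, i < N → ¬ k < N → ¬ (X n = i ∧ X (n + 1) = k) :=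
        ae_all_iff.2 fun i => ae_all_iff.2 fun k => ae_all_iff.2 fun hi => ae_all_iff.2 (h0 i k hi)
      filter_upwards [ih, h1] with X hX hX1
      by_contra hcon
      exact hX1 _ _ hX hcon ⟨rfl, rfl⟩
  have hne : ∀ n, ∀ᵐ X ∂skeletonLaw N, X (n + 1) ≠ X n := by
    intro n
    have h0 : ∀ i, i < N → ∀ᵐ X ∂skeletonLaw N, ¬ (X n = i ∧ X (n + 1) = i) := by
      intro i hi
      have := skeletonLaw_step N n i i MeasurableSet.univ (fun _ _ _ _ => trivial)
      rw [jumpKernel_apply hN hi, if_neg (fun h => h.2 rfl), zero_mul] at this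
      rw [ae_iff]
      simpa using this
    have h1 : ∀ᵐ X ∂skeletonLaw N, ∀ i, i < N → ¬ (X n = i ∧ X (n + 1) = i) :=
      ae_all_iff.2 fun i => ae_all_iff.2 (h0 i)
    filter_upwards [hlt n, h1] with X hX hX1 hcon
    exact hX1 _ hX ⟨rfl, hcon⟩
  exact ae_all_iff.2 fun n => (hlt n).and (hne n)

/-! ### Exponential holding times -/

lemma expMeasure_Ioi {y : ℝ} (hy : 0 ≤ y) :
    expMeasure 1 (Set.Ioi y) = ENNReal.ofReal (Real.exp (-y)) := by
  have h := cdf_expMeasure_eq one_pos y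
  rw [cdf_eq_real, if_pos hy, one_mul] at h
  rw [← Set.compl_Iic, ← ENNReal.ofReal_toReal (measure_ne_top (expMeasure 1) (Set.Iic y)ᶜ)]
  congr 1
  change (expMeasure 1).real (Set.Iic y)ᶜ = _
  rw [probReal_compl_eq_one_sub measurableSet_Iic, h]
  ring

lemma expMeasure_ae_pos : ∀ᵐ y ∂expMeasure 1, 0 < y := by
  have h := expMeasure_Ioi le_rfl
  rw [neg_zero, Real.exp_zero, ENNReal.ofReal_one] at h
  exact mem_ae_iff.2 ((prob_compl_eq_zero_iff measurableSet_Ioi).2 h)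

lemma expMeasure_Iic {y : ℝ} (hy : 0 ≤ y) :
    expMeasure 1 (Set.Iic y) = ENNReal.ofReal (1 - Real.exp (-y)) := by
  have h := cdf_expMeasure_eq one_pos y
  rw [cdf_eq_real, if_pos hy, one_mul] at h
  rw [← ENNReal.ofReal_toReal (measure_ne_top (expMeasure 1) (Set.Iic y)), ← h]
  rfl

/-- A process that starts an exponential clock of rate `r` at time `u` ends it
before time `t` with a probability that is the integral of `r` times the probability that the clock
is running. -/
lemma expMeasure_clock {u t r : ℝ} (hu : 0 ≤ u) (hr : 0 < r) :
    expMeasure 1 {y | u + r⁻¹ * y ≤ t} =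
      ∫⁻ s in Set.Icc 0 t, ENNReal.ofReal r * expMeasure 1 {y | u ≤ s ∧ s < u + r⁻¹ * y} := by
  have hset : {y | u + r⁻¹ * y ≤ t} = Set.Iic (r * (t - u)) := by
    ext y
    rw [Set.mem_ofPred_eq, Set.mem_Iic, ← le_sub_iff_add_le', inv_mul_le_iff₀ hr]
  have hrun : ∀ s, ENNReal.ofReal r * expMeasure 1 {y | u ≤ s ∧ s < u + r⁻¹ * y} =
      exponentialPDF r (s - u) := by
    intro s
    by_cases hus : u ≤ s
    · have h1 : {y | u ≤ s ∧ s < u + r⁻¹ * y} = Set.Ioi (r * (s - u)) := by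
        ext y
        rw [Set.mem_ofPred_eq, Set.mem_Ioi, ← sub_lt_iff_lt_add', lt_inv_mul_iff₀ hr]
        exact and_iff_right hus
      rw [h1, expMeasure_Ioi (mul_nonneg hr.le (sub_nonneg.2 hus)),
        exponentialPDF_of_nonneg (sub_nonneg.2 hus), ← ENNReal.ofReal_mul hr.le]
    · rw [exponentialPDF_of_neg (by linarith)]
      simp [hus]
  simp_rw [hrun]
  have h2 : ∫⁻ s in Set.Icc 0 t, exponentialPDF r (s - u) =
      ∫⁻ s in Set.Iic t, exponentialPDF r (s - u) := by
    rw [← lintegral_indicator measurableSet_Icc, ← lintegral_indicator measurableSet_Iic]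
    refine lintegral_congr fun s => ?_
    by_cases hs : 0 ≤ s
    · simp [Set.indicator_apply, hs]
    · simp [Set.indicator_apply, hs, exponentialPDF_of_neg (show s - u < 0 by linarith)]
  have h3 : ∫⁻ s in Set.Iic t, exponentialPDF r (s - u) =
      ∫⁻ s in Set.Iic (t - u), exponentialPDF r s := by
    rw [← lintegral_indicator measurableSet_Iic, ← lintegral_indicator measurableSet_Iic,
      ← lintegral_sub_right_eq_self ((Set.Iic (t - u)).indicator (exponentialPDF r)) u]
    refine lintegral_congr fun s => ?_
    simp [Set.indicator_apply]
  rw [h2, h3, lintegral_exponentialPDF_eq_antiDeriv hr, hset]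
  split_ifs with h
  · exact expMeasure_Iic (mul_nonneg hr.le h)
  · rw [ENNReal.ofReal_zero]
    refine measure_mono_null (fun y hy => ?_) (ae_iff.1 expMeasure_ae_pos)
    have : r * (t - u) ≤ 0 := mul_nonpos_of_nonneg_of_nonpos hr.le (by linarith)
    have hy' : y ≤ r * (t - u) := hy
    exact not_lt.2 (hy'.trans this)

/-- Lack of memory of the clock. -/
lemma expMeasure_clock_add {u s t r : ℝ} (hr : 0 < r) (ht : 0 ≤ t) :
    expMeasure 1 {y | u ≤ s ∧ s + t < u + r⁻¹ * y} =
      ENNReal.ofReal (Real.exp (-(r * t))) * expMeasure 1 {y | u ≤ s ∧ s < u + r⁻¹ * y} := by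
  by_cases hus : u ≤ s
  · have h1 : ∀ a, {y | u ≤ s ∧ a < u + r⁻¹ * y} = Set.Ioi (r * (a - u)) := by
      intro a
      ext y
      rw [Set.mem_ofPred_eq, Set.mem_Ioi, ← sub_lt_iff_lt_add', lt_inv_mul_iff₀ hr]
      exact and_iff_right hus
    rw [h1, h1, expMeasure_Ioi (mul_nonneg hr.le (by linarith)),
      expMeasure_Ioi (mul_nonneg hr.le (by linarith)), ← ENNReal.ofReal_mul (Real.exp_pos _).le,
      ← Real.exp_add]
    congr 2
    ring
  · simp [hus]

/-! ### The forward equation of the walk -/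

/-- The rate at which the walk on `N` sites leaves the site `i`. -/
noncomputable def exitRate (N : ℕ) (τ : ℕ → ℝ) (i : ℕ) : ℝ := ((N : ℝ) / ((N : ℝ) - 1) * τ i)⁻¹

/-- The event that the walk is, after exactly `n` jumps, at site `i` at time `s`. -/
def visit (N : ℕ) (τ : ℕ → ℝ) (n i : ℕ) (s : ℝ) : Set ((ℕ → ℕ) × (ℕ → ℝ)) :=
  {p | p.1 n = i ∧ jumpTime N τ p n ≤ s ∧ s < jumpTime N τ p (n + 1)}

/-- The probability to be at site `i` at time `s`, as a sum over the number of jumps. -/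
noncomputable def siteProb (N : ℕ) (τ : ℕ → ℝ) (i : ℕ) (s : ℝ) : ℝ≥0∞ :=
  ∑' n, walkMeasure N (visit N τ n i s)

section Walk

variable {N : ℕ} {τ : ℕ → ℝ}

lemma exitRate_pos (hN : 2 ≤ N) (hτ : ∀ i, 0 < τ i) (i : ℕ) : 0 < exitRate N τ i := by
  have : (2 : ℝ) ≤ N := by exact_mod_cast hN
  exact inv_pos.2 (mul_pos (div_pos (by linarith) (by linarith)) (hτ i))

lemma jumpTime_succ (p : (ℕ → ℕ) × (ℕ → ℝ)) (n : ℕ) :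
    jumpTime N τ p (n + 1) = jumpTime N τ p n + (exitRate N τ (p.1 n))⁻¹ * p.2 n := by
  rw [jumpTime, jumpTime, Finset.sum_range_succ, holdingTime, exitRate, inv_inv]

@[fun_prop]
lemma measurable_jumpTime (n : ℕ) : Measurable fun p => jumpTime N τ p n := by
  unfold jumpTime holdingTime
  refine Finset.measurable_sum _ fun k _ => ?_
  have h1 : Measurable fun p : (ℕ → ℕ) × (ℕ → ℝ) => τ (p.1 k) :=
    (measurable_of_countable τ).comp ((measurable_pi_apply k).comp measurable_fst)
  have h2 : Measurable fun p : (ℕ → ℕ) × (ℕ → ℝ) => p.2 k :=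
    (measurable_pi_apply k).comp measurable_snd
  exact (h1.const_mul _).mul h2

lemma measurable_site (n : ℕ) : Measurable fun p : (ℕ → ℕ) × (ℕ → ℝ) => p.1 n :=
  (measurable_pi_apply n).comp measurable_fst

lemma measurableSet_site (n i : ℕ) : MeasurableSet {p : (ℕ → ℕ) × (ℕ → ℝ) | p.1 n = i} :=
  measurableSet_eq_fun (measurable_site n) measurable_const

lemma measurableSet_visit (n i : ℕ) (s : ℝ) : MeasurableSet (visit N τ n i s) :=
  (measurableSet_site n i).inter ((measurableSet_le (measurable_jumpTime n) measurable_const).inter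
    (measurableSet_lt measurable_const (measurable_jumpTime (n + 1))))

lemma measurable_visit (n i : ℕ) : Measurable fun s => walkMeasure N (visit N τ n i s) := by
  refine measurable_measure_prodMk_left (ν := walkMeasure N)
    (s := {z : ℝ × ((ℕ → ℕ) × (ℕ → ℝ)) | z.2 ∈ visit N τ n i z.1}) ?_
  exact (measurable_snd (measurableSet_site n i)).inter
    ((measurableSet_le ((measurable_jumpTime n).comp measurable_snd) measurable_fst).inter
    (measurableSet_lt measurable_fst ((measurable_jumpTime (n + 1)).comp measurable_snd)))

lemma measurable_siteProb (i : ℕ) : Measurable (siteProb N τ i) :=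
  Measurable.tsum fun n => measurable_visit n i

/-- Almost surely, all visited sites exist, each jump changes the site, and all clocks are
positive. -/
lemma walkMeasure_ae (hN : 2 ≤ N) :
    ∀ᵐ p ∂walkMeasure N, ∀ n, p.1 n < N ∧ p.1 (n + 1) ≠ p.1 n ∧ 0 < p.2 n := by
  have h1 : ∀ᵐ p ∂walkMeasure N, ∀ n, p.1 n < N ∧ p.1 (n + 1) ≠ p.1 n :=
    Measure.quasiMeasurePreserving_fst.ae (skeletonLaw_ae hN)
  have h2 : ∀ᵐ ξ ∂Measure.infinitePi (fun _ : ℕ => expMeasure 1), ∀ n, 0 < ξ n :=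
    ae_all_iff.2 fun n =>
      (measurePreserving_eval_infinitePi (fun _ : ℕ => expMeasure 1) n).quasiMeasurePreserving.ae
        expMeasure_ae_pos
  have h3 : ∀ᵐ p ∂walkMeasure N, ∀ n, 0 < p.2 n := Measure.quasiMeasurePreserving_snd.ae h2
  filter_upwards [h1, h3] with p hp hp' n
  exact ⟨(hp n).1, (hp n).2, hp' n⟩

lemma strictMono_jumpTime (hN : 2 ≤ N) (hτ : ∀ i, 0 < τ i) {p : (ℕ → ℕ) × (ℕ → ℝ)}
    (hp : ∀ n, 0 < p.2 n) : StrictMono (jumpTime N τ p) :=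
  strictMono_nat_of_lt_succ fun n => by
    rw [jumpTime_succ]
    exact lt_add_of_pos_right _ (mul_pos (inv_pos.2 (exitRate_pos hN hτ _)) (hp n))

/-- The clock of the `n`-th visited site is independent of this site and of the time of the
`n`-th jump. -/
lemma map_walkMeasure (n : ℕ) :
    (walkMeasure N).map (fun p => ((p.1 n, jumpTime N τ p n), p.2 n)) =
      ((walkMeasure N).map (fun p => (p.1 n, jumpTime N τ p n))).prod (expMeasure 1) := by
  set Ξ := Measure.infinitePi (fun _ : ℕ => expMeasure 1)
  set trunc : (ℕ → ℝ) → ℕ → ℝ := fun ξ k => if k < n then ξ k else 0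
  have htrunc : Measurable trunc := by
    refine measurable_pi_lambda _ fun k => ?_
    by_cases hk : k < n
    · simpa only [trunc, if_pos hk] using measurable_pi_apply k
    · simp only [trunc, if_neg hk, measurable_const]
  have hind : IndepFun trunc (fun ξ : ℕ → ℝ => ξ n) Ξ := by
    have h1 : iIndepFun (fun (k : ℕ) (ξ : ℕ → ℝ) => ξ k) Ξ :=
      iIndepFun_infinitePi (X := fun _ (y : ℝ) => y) (fun _ => measurable_id)
    have h2 := h1.indepFun_finset (Finset.range n) {n} (by simp) fun k => measurable_pi_apply k
    have hψ : Measurable fun v : ({n} : Finset ℕ) → ℝ => v ⟨n, Finset.mem_singleton_self n⟩ :=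
      measurable_pi_apply _
    refine h2.comp (φ := fun v k => if hk : k < n then v ⟨k, Finset.mem_range.2 hk⟩ else 0)
      (ψ := fun v => v ⟨n, Finset.mem_singleton_self n⟩) ?_ hψ
    refine measurable_pi_lambda _ fun k => ?_
    by_cases hk : k < n
    · simpa only [dif_pos hk] using measurable_pi_apply _
    · simp only [dif_neg hk, measurable_const]
  have hΞ : Ξ.map (fun ξ => (trunc ξ, ξ n)) = (Ξ.map trunc).prod (expMeasure 1) := by
    rw [(indepFun_iff_map_prod_eq_prod_map_map htrunc.aemeasurable
      (measurable_pi_apply n).aemeasurable).1 hind]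
    congr 1
    exact Measure.infinitePi_map_eval _ n
  set F : (ℕ → ℕ) × (ℕ → ℝ) → ℕ × ℝ := fun p => (p.1 n, jumpTime N τ p n)
  have hF : Measurable F := (measurable_site n).prodMk (measurable_jumpTime n)
  have hFt : ∀ p : (ℕ → ℕ) × (ℕ → ℝ), F (p.1, trunc p.2) = F p := by
    intro p
    simp only [F, jumpTime, holdingTime]
    congr 1
    exact Finset.sum_congr rfl fun k hk => by simp [trunc, Finset.mem_range.1 hk]
  have hsplit : Measurable fun ξ : ℕ → ℝ => (trunc ξ, ξ n) := htrunc.prodMk (measurable_pi_apply n)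
  have hleft : (walkMeasure N).map F = ((skeletonLaw N).prod (Ξ.map trunc)).map F := by
    have h1 : (skeletonLaw N).prod (Ξ.map trunc) = (walkMeasure N).map (Prod.map id trunc) := by
      rw [walkMeasure, ← Measure.map_prod_map _ _ measurable_id htrunc, Measure.map_id]
    rw [h1, Measure.map_map hF (measurable_id.prodMap htrunc)]
    congr 1
    exact funext fun p => (hFt p).symm
  have hright : (walkMeasure N).map (fun p => ((p.1, trunc p.2), p.2 n)) =
      ((skeletonLaw N).prod (Ξ.map trunc)).prod (expMeasure 1) := by
    have h1 : (skeletonLaw N).prod ((Ξ.map trunc).prod (expMeasure 1)) =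
        (walkMeasure N).map (Prod.map id fun ξ => (trunc ξ, ξ n)) := by
      rw [walkMeasure, ← Measure.map_prod_map _ _ measurable_id hsplit, Measure.map_id, hΞ]
    rw [← MeasurePreserving.map_eq
      ((measurePreserving_prodAssoc (skeletonLaw N) (Ξ.map trunc) (expMeasure 1)).symm),
      h1, Measure.map_map (MeasurableEquiv.measurable _) (measurable_id.prodMap hsplit)]
    rfl
  have : IsProbabilityMeasure (Ξ.map trunc) :=
    Measure.isProbabilityMeasure_map htrunc.aemeasurable
  have hprod := Measure.map_prod_map ((skeletonLaw N).prod (Ξ.map trunc)) (expMeasure 1) hF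
    measurable_id
  rw [Measure.map_id] at hprod
  have hmeas : Measurable fun p : (ℕ → ℕ) × (ℕ → ℝ) => ((p.1, trunc p.2), p.2 n) :=
    (measurable_fst.prodMk (htrunc.comp measurable_snd)).prodMk
      ((measurable_pi_apply n).comp measurable_snd)
  rw [hleft, hprod, ← hright,
    Measure.map_map (hF.prodMap measurable_id) hmeas]
  congr 1
  exact funext fun p => Prod.ext (hFt p).symm rfl

lemma walkMeasure_clock (n : ℕ) {D : Set ((ℕ × ℝ) × ℝ)} (hD : MeasurableSet D) :
    walkMeasure N {p | ((p.1 n, jumpTime N τ p n), p.2 n) ∈ D} =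
      ∫⁻ z, expMeasure 1 {y | (z, y) ∈ D}
        ∂(walkMeasure N).map (fun p => (p.1 n, jumpTime N τ p n)) := by
  have hm : Measurable fun p : (ℕ → ℕ) × (ℕ → ℝ) => ((p.1 n, jumpTime N τ p n), p.2 n) :=
    ((measurable_site n).prodMk (measurable_jumpTime n)).prodMk
      ((measurable_pi_apply n).comp measurable_snd)
  have h1 := Measure.map_apply (μ := walkMeasure N) hm hD
  rw [map_walkMeasure, Measure.prod_apply hD] at h1
  exact h1.symm

lemma measurableSet_clock (i : ℕ) (r : ℝ) :
    MeasurableSet {w : ((ℕ × ℝ) × ℝ) × ℝ | w.1.1.1 = i ∧ w.1.1.2 + r * w.2 ≤ w.1.2} := by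
  have h1 : MeasurableSet {w : ((ℕ × ℝ) × ℝ) × ℝ | w.1.1.1 = i} :=
    measurableSet_eq_fun (by fun_prop) measurable_const
  have h2 : MeasurableSet {w : ((ℕ × ℝ) × ℝ) × ℝ | w.1.1.2 + r * w.2 ≤ w.1.2} :=
    measurableSet_le (by fun_prop) (by fun_prop)
  exact h1.inter h2

lemma measurableSet_clock_running (i : ℕ) (r t : ℝ) : MeasurableSet
    {w : ((ℕ × ℝ) × ℝ) × ℝ | w.1.1.1 = i ∧ w.1.1.2 ≤ w.1.2 ∧ w.1.2 + t < w.1.1.2 + r * w.2} := by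
  have h1 : MeasurableSet {w : ((ℕ × ℝ) × ℝ) × ℝ | w.1.1.1 = i} :=
    measurableSet_eq_fun (by fun_prop) measurable_const
  have h2 : MeasurableSet {w : ((ℕ × ℝ) × ℝ) × ℝ | w.1.1.2 ≤ w.1.2} :=
    measurableSet_le (by fun_prop) (by fun_prop)
  have h3 : MeasurableSet {w : ((ℕ × ℝ) × ℝ) × ℝ | w.1.2 + t < w.1.1.2 + r * w.2} :=
    measurableSet_lt (by fun_prop) (by fun_prop)
  exact h1.inter (h2.inter h3)

lemma walkMeasure_running (n i : ℕ) (s t : ℝ) :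
    walkMeasure N {p | p.1 n = i ∧ jumpTime N τ p n ≤ s ∧ s + t < jumpTime N τ p (n + 1)} =
      ∫⁻ z, expMeasure 1 {y | z.1 = i ∧ z.2 ≤ s ∧ s + t < z.2 + (exitRate N τ i)⁻¹ * y}
        ∂(walkMeasure N).map (fun p => (p.1 n, jumpTime N τ p n)) := by
  have hD : MeasurableSet
      {w : (ℕ × ℝ) × ℝ | w.1.1 = i ∧ w.1.2 ≤ s ∧ s + t < w.1.2 + (exitRate N τ i)⁻¹ * w.2} :=
    (measurableSet_clock_running i (exitRate N τ i)⁻¹ t).preimage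
      (f := fun w : (ℕ × ℝ) × ℝ => ((w.1, s), w.2)) (by fun_prop)
  refine Eq.trans ?_ (walkMeasure_clock n hD)
  congr 1
  ext p
  simp only [Set.mem_ofPred_eq, jumpTime_succ]
  exact and_congr_right fun h => by rw [h]

lemma walkMeasure_visit (n i : ℕ) (s : ℝ) :
    walkMeasure N (visit N τ n i s) =
      ∫⁻ z, expMeasure 1 {y | z.1 = i ∧ z.2 ≤ s ∧ s < z.2 + (exitRate N τ i)⁻¹ * y}
        ∂(walkMeasure N).map (fun p => (p.1 n, jumpTime N τ p n)) := by
  simpa [visit] using walkMeasure_running (N := N) (τ := τ) n i s 0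

/-- The probability to stay at the current site for a further time `t` is `exp (-(r * t))`. -/
lemma walkMeasure_running_eq (hN : 2 ≤ N) (hτ : ∀ i, 0 < τ i) (n i : ℕ) (s : ℝ) {t : ℝ}
    (ht : 0 ≤ t) :
    walkMeasure N {p | p.1 n = i ∧ jumpTime N τ p n ≤ s ∧ s + t < jumpTime N τ p (n + 1)} =
      ENNReal.ofReal (Real.exp (-(exitRate N τ i * t))) * walkMeasure N (visit N τ n i s) := by
  rw [walkMeasure_running, walkMeasure_visit, ← lintegral_const_mul' _ _ ENNReal.ofReal_ne_top]
  refine lintegral_congr fun z => ?_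
  by_cases hz : z.1 = i
  · simpa only [hz, true_and] using expMeasure_clock_add (exitRate_pos hN hτ i) ht
  · simp [hz]

/-- The `n`-th visited site, if it is `i`, is left at rate `exitRate N τ i`. -/
lemma walkMeasure_leave (hN : 2 ≤ N) (hτ : ∀ i, 0 < τ i) (n i : ℕ) (t : ℝ) :
    walkMeasure N {p | p.1 n = i ∧ jumpTime N τ p (n + 1) ≤ t} =
      ∫⁻ s in Set.Icc 0 t, ENNReal.ofReal (exitRate N τ i) * walkMeasure N (visit N τ n i s) := by
  set ρ := (walkMeasure N).map (fun p => (p.1 n, jumpTime N τ p n))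
  set r := exitRate N τ i
  have hF : Measurable fun p : (ℕ → ℕ) × (ℕ → ℝ) => (p.1 n, jumpTime N τ p n) :=
    (measurable_site n).prodMk (measurable_jumpTime n)
  have hρ : ∀ᵐ z ∂ρ, 0 ≤ z.2 := by
    rw [ae_map_iff hF.aemeasurable (measurableSet_le measurable_const measurable_snd)]
    filter_upwards [walkMeasure_ae hN] with p hp
    simpa [jumpTime] using
      (strictMono_jumpTime hN hτ fun n => (hp n).2.2).monotone (Nat.zero_le n)
  have hD : MeasurableSet {w : (ℕ × ℝ) × ℝ | w.1.1 = i ∧ w.1.2 + r⁻¹ * w.2 ≤ t} :=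
    (measurableSet_clock i r⁻¹).preimage
      (f := fun w : (ℕ × ℝ) × ℝ => ((w.1, t), w.2)) (by fun_prop)
  have h1 : {p | p.1 n = i ∧ jumpTime N τ p (n + 1) ≤ t} =
      {p | ((p.1 n, jumpTime N τ p n), p.2 n) ∈
        {w : (ℕ × ℝ) × ℝ | w.1.1 = i ∧ w.1.2 + r⁻¹ * w.2 ≤ t}} := by
    ext p
    simp only [Set.mem_ofPred_eq, jumpTime_succ]
    exact and_congr_right fun h => by rw [h]
  rw [h1, walkMeasure_clock n hD]
  calc ∫⁻ z : ℕ × ℝ, expMeasure 1 {y | z.1 = i ∧ z.2 + r⁻¹ * y ≤ t} ∂ρ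
      = ∫⁻ z : ℕ × ℝ, (∫⁻ s in Set.Icc 0 t, ENNReal.ofReal r *
          expMeasure 1 {y | z.1 = i ∧ z.2 ≤ s ∧ s < z.2 + r⁻¹ * y}) ∂ρ := by
        refine lintegral_congr_ae ?_
        filter_upwards [hρ] with z hz
        by_cases hzi : z.1 = i
        · simpa only [hzi, true_and] using expMeasure_clock hz (exitRate_pos hN hτ i)
        · simp [hzi]
    _ = ∫⁻ s in Set.Icc 0 t, ∫⁻ z : ℕ × ℝ, ENNReal.ofReal r *
          expMeasure 1 {y | z.1 = i ∧ z.2 ≤ s ∧ s < z.2 + r⁻¹ * y} ∂ρ := by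
        refine lintegral_lintegral_swap (Measurable.aemeasurable ?_)
        refine Measurable.const_mul ?_ _
        have := measurable_measure_prodMk_left (ν := expMeasure 1)
          (measurableSet_clock_running i r⁻¹ 0)
        simpa [Function.uncurry_def] using this
    _ = _ := by
        refine lintegral_congr fun s => ?_
        rw [lintegral_const_mul' _ _ ENNReal.ofReal_ne_top, walkMeasure_visit]

lemma walkMeasure_arrive (hN : 2 ≤ N) (n k : ℕ) (t : ℝ) :
    walkMeasure N {p | p.1 (n + 1) = k ∧ jumpTime N τ p (n + 1) ≤ t} =
      ∑ i ∈ Finset.range N, jumpKernel N i {k} *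
        walkMeasure N {p | p.1 n = i ∧ jumpTime N τ p (n + 1) ≤ t} := by
  have hm : ∀ m i, MeasurableSet
      {p : (ℕ → ℕ) × (ℕ → ℝ) | p.1 m = i ∧ jumpTime N τ p (n + 1) ≤ t} := fun m i =>
    (measurableSet_site m i).inter (measurableSet_le (measurable_jumpTime _) measurable_const)
  have h1 : ∀ i, jumpKernel N i {k} * walkMeasure N {p | p.1 n = i ∧ jumpTime N τ p (n + 1) ≤ t} =
      ∫⁻ ξ, jumpKernel N i {k} * skeletonLaw N {X | X n = i ∧ jumpTime N τ (X, ξ) (n + 1) ≤ t}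
        ∂Measure.infinitePi (fun _ : ℕ => expMeasure 1) := by
    intro i
    rw [lintegral_const_mul' _ _ (measure_ne_top _ _), walkMeasure,
      Measure.prod_apply_symm (hm n i)]
    rfl
  have hmeas : ∀ i ∈ Finset.range N, AEMeasurable (fun ξ => jumpKernel N i {k} *
      skeletonLaw N {X | X n = i ∧ jumpTime N τ (X, ξ) (n + 1) ≤ t})
      (Measure.infinitePi (fun _ : ℕ => expMeasure 1)) := fun i _ =>
    ((measurable_measure_prodMk_right (μ := skeletonLaw N) (hm n i)).const_mul _).aemeasurable
  simp_rw [h1]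
  rw [← lintegral_finsetSum' _ hmeas, walkMeasure, Measure.prod_apply_symm (hm (n + 1) k)]
  refine lintegral_congr fun ξ => ?_
  set A : Set (ℕ → ℕ) := {X | jumpTime N τ (X, ξ) (n + 1) ≤ t}
  have hA : MeasurableSet A :=
    measurableSet_le ((measurable_jumpTime _).comp (measurable_id.prodMk measurable_const))
      measurable_const
  have hAn : ∀ X X' : ℕ → ℕ, (∀ j ≤ n, X j = X' j) → X ∈ A → X' ∈ A := by
    intro X X' h hX
    have : jumpTime N τ (X', ξ) (n + 1) = jumpTime N τ (X, ξ) (n + 1) :=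
      Finset.sum_congr rfl fun j hj => by
        simp only [holdingTime, h j (Nat.lt_succ_iff.1 (Finset.mem_range.1 hj))]
    simpa only [A, Set.mem_ofPred_eq, this] using hX
  have h2 : ∀ i, jumpKernel N i {k} * skeletonLaw N {X | X n = i ∧
      jumpTime N τ (X, ξ) (n + 1) ≤ t} = skeletonLaw N {X | X ∈ A ∧ X n = i ∧ X (n + 1) = k} := by
    intro i
    rw [skeletonLaw_step N n i k hA hAn]
    congr 2
    ext X
    exact and_comm
  simp_rw [h2]
  have hcoord : ∀ m i, MeasurableSet {X : ℕ → ℕ | X m = i} := fun m i =>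
    measurableSet_eq_fun (measurable_pi_apply m) measurable_const
  have hstep : ∀ i, MeasurableSet {X : ℕ → ℕ | X ∈ A ∧ X n = i ∧ X (n + 1) = k} := fun i =>
    hA.inter ((hcoord n i).inter (hcoord (n + 1) k))
  rw [← measure_biUnion_finset
    (fun i _ j _ hij => Set.disjoint_left.2 fun X hX hX' => hij (hX.2.1.symm.trans hX'.2.1))
    (fun i _ => hstep i)]
  refine measure_congr (Filter.eventuallyEq_set.2 ?_)
  filter_upwards [skeletonLaw_ae hN] with X hX
  simp only [Set.mem_iUnion, Finset.mem_range, exists_prop]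
  constructor
  · exact fun h => ⟨X n, (hX n).1, h.2, rfl, h.1⟩
  · rintro ⟨i, _, h1, _, h3⟩
    exact ⟨h3, h1⟩

lemma walkMeasure_visit_add (hN : 2 ≤ N) (hτ : ∀ i, 0 < τ i) (n k : ℕ) (t : ℝ) :
    walkMeasure N (visit N τ n k t) +
        walkMeasure N {p | p.1 n = k ∧ jumpTime N τ p (n + 1) ≤ t} =
      walkMeasure N {p | p.1 n = k ∧ jumpTime N τ p n ≤ t} := by
  have hm : MeasurableSet
      {p : (ℕ → ℕ) × (ℕ → ℝ) | p.1 n = k ∧ jumpTime N τ p (n + 1) ≤ t} :=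
    (measurableSet_site n k).inter (measurableSet_le (measurable_jumpTime _) measurable_const)
  rw [← measure_union (Set.disjoint_left.2 fun p hp hp' => not_lt.2 hp'.2 hp.2.2) hm]
  refine measure_congr (Filter.eventuallyEq_set.2 ?_)
  filter_upwards [walkMeasure_ae hN] with p hp
  have hlt := strictMono_jumpTime hN hτ (fun n => (hp n).2.2) n.lt_succ_self
  simp only [visit, Set.mem_union, Set.mem_ofPred_eq]
  constructor
  · rintro (h | h)
    · exact ⟨h.1, h.2.1⟩
    · exact ⟨h.1, hlt.le.trans h.2⟩
  · intro h
    rcases lt_or_ge t (jumpTime N τ p (n + 1)) with h1 | h1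
    · exact Or.inl ⟨h.1, h.2, h1⟩
    · exact Or.inr ⟨h.1, h1⟩

/-- Balance of mass: the mass at `k` and the mass that has left `k` up to time `t` add up to the
initial mass and the mass that has arrived. -/
lemma siteProb_balance (hN : 2 ≤ N) (hτ : ∀ i, 0 < τ i) {k : ℕ} (hk : k < N) {t : ℝ}
    (ht : 0 ≤ t) :
    siteProb N τ k t + ∫⁻ s in Set.Icc 0 t, ENNReal.ofReal (exitRate N τ k) * siteProb N τ k s =
      (N : ℝ≥0∞)⁻¹ + ∑ i ∈ Finset.range N, jumpKernel N i {k} *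
        ∫⁻ s in Set.Icc 0 t, ENNReal.ofReal (exitRate N τ i) * siteProb N τ i s := by
  have h1 : ∀ i, ∫⁻ s in Set.Icc 0 t, ENNReal.ofReal (exitRate N τ i) * siteProb N τ i s =
      ∑' n, walkMeasure N {p | p.1 n = i ∧ jumpTime N τ p (n + 1) ≤ t} := by
    intro i
    simp_rw [siteProb, ← ENNReal.tsum_mul_left]
    rw [lintegral_tsum fun n => ((measurable_visit n i).const_mul _).aemeasurable]
    exact tsum_congr fun n => (walkMeasure_leave hN hτ n i t).symm
  simp_rw [h1, ← ENNReal.tsum_mul_left]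
  rw [siteProb, ← ENNReal.tsum_add, tsum_congr fun n => walkMeasure_visit_add hN hτ n k t,
    tsum_eq_zero_add' ENNReal.summable, tsum_congr fun n => walkMeasure_arrive hN n k t,
    Summable.tsum_finsetSum fun i _ => ENNReal.summable]
  congr 1
  rw [← skeletonLaw_zero hk]
  have h2 : {p | p.1 0 = k ∧ jumpTime N τ p 0 ≤ t} =
      ({X | X 0 = k} : Set (ℕ → ℕ)) ×ˢ (Set.univ : Set (ℕ → ℝ)) := by
    ext p
    simp [jumpTime, ht]
  rw [h2, walkMeasure, Measure.prod_prod, measure_univ, mul_one]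

/-- Up to null sets, the number of jumps before time `s` is unique, whichever sites are visited. -/
lemma aedisjoint_visit (hN : 2 ≤ N) (hτ : ∀ i, 0 < τ i) (k : ℕ → ℕ) (s : ℝ) :
    Pairwise (Function.onFun (AEDisjoint (walkMeasure N)) fun n => visit N τ n (k n) s) := by
  intro m n hmn
  refine measure_mono_null (t := {p | ¬ ∀ n, p.1 n < N ∧ p.1 (n + 1) ≠ p.1 n ∧ 0 < p.2 n}) ?_
    (ae_iff.1 (walkMeasure_ae hN))
  intro p hp hpos
  have hmono := (strictMono_jumpTime hN hτ fun n => (hpos n).2.2).monotone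
  rcases Nat.lt_or_gt_of_ne hmn with h | h
  · exact absurd (hp.1.2.2.trans_le (hmono h)) (not_lt.2 hp.2.2.1)
  · exact absurd (hp.2.2.2.trans_le (hmono h)) (not_lt.2 hp.1.2.1)

lemma siteProb_eq (hN : 2 ≤ N) (hτ : ∀ i, 0 < τ i) (k : ℕ) (s : ℝ) :
    siteProb N τ k s = walkMeasure N (⋃ n, visit N τ n k s) :=
  (measure_iUnion₀ (aedisjoint_visit hN hτ (fun _ => k) s) fun n =>
    (measurableSet_visit n k s).nullMeasurableSet).symm

lemma siteProb_le_one (hN : 2 ≤ N) (hτ : ∀ i, 0 < τ i) (k : ℕ) (s : ℝ) :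
    siteProb N τ k s ≤ 1 := siteProb_eq hN hτ k s ▸ prob_le_one

/-- The occupation probabilities of the walk solve the forward equation. -/
lemma isUniformFlow_siteProb (hN : 2 ≤ N) (hτ : ∀ i, 0 < τ i) :
    IsUniformFlow N (fun i => (τ i)⁻¹) (fun k t => (siteProb N τ k t).toReal) := by
  have hN2 : (2 : ℝ) ≤ N := by exact_mod_cast hN
  have hN0 : (N : ℝ) ≠ 0 := by linarith
  have hN1 : (N : ℝ) - 1 ≠ 0 := by linarith
  set p : ℕ → ℝ → ℝ := fun k t => (siteProb N τ k t).toReal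
  have hp_le : ∀ k t, p k t ≤ 1 := fun k t =>
    ENNReal.toReal_le_of_le_ofReal zero_le_one (by simpa using siteProb_le_one hN hτ k t)
  have hint : ∀ k a b, IntervalIntegrable (p k) volume a b := fun k a b =>
    intervalIntegrable_const (c := (1 : ℝ)).mono_fun
      (measurable_siteProb k).ennreal_toReal.aestronglyMeasurable
      (.of_forall fun t => by
        have h0 : 0 ≤ p k t := ENNReal.toReal_nonneg
        simpa [abs_of_nonneg h0] using hp_le k t)
  set I : ℕ → ℝ → ℝ := fun k t => ∫ s in (0 : ℝ)..t, p k s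
  have hIc : ∀ k, Continuous (I k) := fun k => intervalIntegral.continuous_primitive (hint k) 0
  have hlint : ∀ k t, 0 ≤ t → ∫⁻ s in Set.Icc 0 t, ENNReal.ofReal (exitRate N τ k) *
      siteProb N τ k s = ENNReal.ofReal (exitRate N τ k * I k t) := by
    intro k t ht
    have hfin : ∫⁻ s in Set.Icc 0 t, siteProb N τ k s ≠ ∞ := by
      refine ((setLIntegral_mono measurable_const fun s _ =>
        siteProb_le_one hN hτ k s).trans_lt ?_).ne
      simp
    rw [lintegral_const_mul' _ _ ENNReal.ofReal_ne_top,
      ENNReal.ofReal_mul (exitRate_pos hN hτ k).le]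
    congr 1
    simp only [I, p]
    rw [intervalIntegral.integral_of_le ht, ← integral_Icc_eq_integral_Ioc,
      integral_toReal (measurable_siteProb k).aemeasurable
        (.of_forall fun s => (siteProb_le_one hN hτ k s).trans_lt ENNReal.one_lt_top),
      ENNReal.ofReal_toReal hfin]
  have hI0 : ∀ k t, 0 ≤ t → 0 ≤ I k t := fun k t ht =>
    intervalIntegral.integral_nonneg ht fun s _ => ENNReal.toReal_nonneg
  have hrate : ∀ k, exitRate N τ k = (τ k)⁻¹ * (((N : ℝ) - 1) / N) := by
    intro k
    rw [exitRate, mul_inv, inv_div, mul_comm]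
  have hjump : ∀ k < N, ∀ i ∈ Finset.range N, ∀ t, 0 ≤ t →
      (jumpKernel N i {k} * ENNReal.ofReal (exitRate N τ i * I i t)).toReal =
        if i = k then 0 else (τ i)⁻¹ * I i t / N := by
    intro k hk i hi t ht
    rw [jumpKernel_apply hN (Finset.mem_range.1 hi), ENNReal.toReal_mul,
      ENNReal.toReal_ofReal (mul_nonneg (exitRate_pos hN hτ i).le (hI0 i t ht)), hrate]
    by_cases hik : i = k
    · simp [hik]
    · rw [if_pos ⟨hk, fun h => hik h.symm⟩, if_neg hik, ENNReal.toReal_inv, ENNReal.toReal_natCast,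
        Nat.cast_sub (by omega), Nat.cast_one]
      field_simp
  have hmain : ∀ k < N, ∀ t, 0 ≤ t → p k t =
      (N : ℝ)⁻¹ + (∑ i ∈ Finset.range N, (τ i)⁻¹ * I i t) / N - (τ k)⁻¹ * I k t := by
    intro k hk t ht
    have h1 := siteProb_balance hN hτ hk ht
    rw [hlint k t ht, Finset.sum_congr rfl fun i _ => by rw [hlint i t ht]] at h1
    have h2 := congrArg ENNReal.toReal h1
    rw [ENNReal.toReal_add (ne_top_of_le_ne_top ENNReal.one_ne_top (siteProb_le_one hN hτ k t))
      ENNReal.ofReal_ne_top, ENNReal.toReal_ofReal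
        (mul_nonneg (exitRate_pos hN hτ k).le (hI0 k t ht)),
      ENNReal.toReal_add (by simp; omega) (ENNReal.sum_ne_top.2 fun i _ =>
        ENNReal.mul_ne_top (measure_ne_top _ _) ENNReal.ofReal_ne_top),
      ENNReal.toReal_sum fun i _ => ENNReal.mul_ne_top (measure_ne_top _ _) ENNReal.ofReal_ne_top,
      Finset.sum_congr rfl fun i hi => hjump k hk i hi t ht, ENNReal.toReal_inv,
      ENNReal.toReal_natCast] at h2
    have h3 : ∑ i ∈ Finset.range N, (if i = k then 0 else (τ i)⁻¹ * I i t / N) =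
        (∑ i ∈ Finset.range N, (τ i)⁻¹ * I i t) / N - (τ k)⁻¹ * I k t / N := by
      rw [eq_sub_iff_add_eq, Finset.sum_div,
        ← Finset.add_sum_erase _ _ (Finset.mem_range.2 hk),
        ← Finset.add_sum_erase _ (fun i => (τ i)⁻¹ * I i t / N) (Finset.mem_range.2 hk), if_pos rfl,
        zero_add, add_comm]
      congr 1
      exact Finset.sum_congr rfl fun i hi => if_neg (Finset.ne_of_mem_erase hi)
    rw [h3, hrate] at h2
    have h4 : (τ k)⁻¹ * (((N : ℝ) - 1) / N) * I k t = (τ k)⁻¹ * I k t - (τ k)⁻¹ * I k t / N := by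
      field_simp
    change p k t + _ = _ at h2
    linarith
  have hcont : ∀ k < N, ContinuousOn (p k) (Set.Ici 0) := fun k hk =>
    ContinuousOn.congr (Continuous.continuousOn (by fun_prop)) fun t ht => hmain k hk t ht
  have hId : ∀ k < N, ∀ t, 0 < t → HasDerivAt (I k) (p k t) t := fun k hk t ht =>
    intervalIntegral.integral_hasDerivAt_right (hint k 0 t)
      ((measurable_siteProb k).ennreal_toReal.stronglyMeasurable.stronglyMeasurableAtFilter)
      ((hcont k hk).continuousAt (Ici_mem_nhds ht))
  refine ⟨fun k t _ => ENNReal.toReal_nonneg, fun t ht => ?_, hcont, fun k hk => ?_,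
    fun k hk t ht => ?_⟩
  · rw [Finset.sum_congr rfl fun k hk => hmain k (Finset.mem_range.1 hk) t ht]
    rw [Finset.sum_sub_distrib, Finset.sum_const, Finset.card_range, nsmul_eq_mul]
    field_simp
    ring
  · have := hmain k hk 0 le_rfl
    simpa [I] using this
  · have h1 : HasDerivAt (fun t => (N : ℝ)⁻¹ + (∑ i ∈ Finset.range N, (τ i)⁻¹ * I i t) / N
        - (τ k)⁻¹ * I k t)
        ((∑ i ∈ Finset.range N, (τ i)⁻¹ * p i t) / N - (τ k)⁻¹ * p k t) t :=
      (((HasDerivAt.fun_sum fun i hi =>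
        (hId i (Finset.mem_range.1 hi) t ht).const_mul _).div_const _).const_add _).sub
        ((hId k hk t ht).const_mul _)
    refine h1.congr_of_eventuallyEq ?_
    filter_upwards [Ici_mem_nhds ht] with s hs
    exact hmain k hk s hs

/-! ### Occupation and correlation probabilities -/

lemma walk_eq {p : (ℕ → ℕ) × (ℕ → ℝ)} (hp : Monotone (jumpTime N τ p)) {n : ℕ} {s : ℝ}
    (h1 : jumpTime N τ p n ≤ s) (h2 : s < jumpTime N τ p (n + 1)) : walk N τ s p = p.1 n := by
  have : {m : ℕ | jumpTime N τ p m ≤ s} = Set.Iic n := by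
    ext m
    refine ⟨fun hm => ?_, fun hm => (hp hm).trans h1⟩
    by_contra hcon
    exact absurd (h2.trans_le (hp (Nat.lt_of_not_le hcon))) (not_lt.2 hm)
  rw [walk, this, csSup_Iic]

/-- The walk does not explode: total mass is conserved by the forward equation. -/
lemma walkMeasure_ae_visit (hN : 2 ≤ N) (hτ : ∀ i, 0 < τ i) {s : ℝ} (hs : 0 ≤ s) :
    ∀ᵐ p ∂walkMeasure N, ∃ n, p ∈ visit N τ n (p.1 n) s := by
  set U : Set ((ℕ → ℕ) × (ℕ → ℝ)) := ⋃ k ∈ Finset.range N, ⋃ n, visit N τ n k s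
  have hmeas : ∀ k, MeasurableSet (⋃ n, visit N τ n k s) := fun k =>
    MeasurableSet.iUnion fun n => measurableSet_visit n k s
  have hU : walkMeasure N U = 1 := by
    rw [measure_biUnion_finset₀ ?_ fun k _ => (hmeas k).nullMeasurableSet]
    · simp_rw [← siteProb_eq hN hτ]
      have h1 := (isUniformFlow_siteProb hN hτ).sum_eq_one s hs
      rw [← ENNReal.toReal_sum fun k _ =>
        ne_top_of_le_ne_top ENNReal.one_ne_top (siteProb_le_one hN hτ k s)] at h1
      rwa [ENNReal.toReal_eq_one_iff] at h1
    · intro j _ k _ hjk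
      refine AEDisjoint.iUnion_left_iff.2 fun m => AEDisjoint.iUnion_right_iff.2 fun n => ?_
      by_cases hmn : m = n
      · subst hmn
        exact (Set.disjoint_left.2 fun p hp hp' => hjk (hp.1.symm.trans hp'.1)).aedisjoint
      · simpa [hmn, Ne.symm hmn, Function.onFun] using
          aedisjoint_visit hN hτ (fun l => if l = m then j else k) s hmn
  have h0 := (prob_compl_eq_zero_iff (MeasurableSet.biUnion (Finset.countable_toSet _)
    fun k _ => hmeas k)).2 hU
  filter_upwards [compl_mem_ae_iff.2 h0] with p hp
  rw [compl_compl] at hp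
  simp only [Set.mem_iUnion] at hp
  obtain ⟨k, _, n, hpn⟩ := hp
  exact ⟨n, rfl, hpn.2⟩

lemma walkMeasure_walk_eq (hN : 2 ≤ N) (hτ : ∀ i, 0 < τ i) (k : ℕ) {s : ℝ} (hs : 0 ≤ s) :
    walkMeasure N {p | walk N τ s p = k} = siteProb N τ k s := by
  rw [siteProb_eq hN hτ]
  refine measure_congr (Filter.eventuallyEq_set.2 ?_)
  filter_upwards [walkMeasure_ae hN, walkMeasure_ae_visit hN hτ hs] with p hp hpn
  have hmono := (strictMono_jumpTime hN hτ fun n => (hp n).2.2).monotone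
  obtain ⟨n, hpn⟩ := hpn
  rw [Set.mem_iUnion]
  constructor
  · intro h
    exact ⟨n, (walk_eq hmono hpn.2.1 hpn.2.2).symm.trans h, hpn.2⟩
  · rintro ⟨m, hm⟩
    exact (walk_eq hmono hm.2.1 hm.2.2).trans hm.1

/-- The walk stays at its site during `[s, s + t]` if and only if it does not jump. -/
lemma walkMeasure_stay (hN : 2 ≤ N) (hτ : ∀ i, 0 < τ i) {s t : ℝ} (hs : 0 ≤ s) (ht : 0 ≤ t) :
    walkMeasure N {p | ∀ u ∈ Set.Icc s (s + t), walk N τ u p = walk N τ s p} =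
      ∑ k ∈ Finset.range N, ENNReal.ofReal (Real.exp (-(exitRate N τ k * t))) *
        siteProb N τ k s := by
  set R : ℕ → ℕ → Set ((ℕ → ℕ) × (ℕ → ℝ)) := fun k n =>
    {p | p.1 n = k ∧ jumpTime N τ p n ≤ s ∧ s + t < jumpTime N τ p (n + 1)}
  have hRm : ∀ k n, MeasurableSet (R k n) := fun k n => (measurableSet_site n k).inter
    ((measurableSet_le (measurable_jumpTime n) measurable_const).inter
      (measurableSet_lt measurable_const (measurable_jumpTime (n + 1))))
  have hRv : ∀ k n, R k n ⊆ visit N τ n k s := fun k n p hp =>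
    ⟨hp.1, hp.2.1, (le_add_of_nonneg_right ht).trans_lt hp.2.2⟩
  have hR : ∀ k, ENNReal.ofReal (Real.exp (-(exitRate N τ k * t))) * siteProb N τ k s =
      walkMeasure N (⋃ n, R k n) := by
    intro k
    rw [siteProb, ← ENNReal.tsum_mul_left, measure_iUnion₀
      (fun m n hmn => (aedisjoint_visit hN hτ (fun _ => k) s hmn).mono (hRv k m) (hRv k n))
      fun n => (hRm k n).nullMeasurableSet]
    exact tsum_congr fun n => (walkMeasure_running_eq hN hτ n k s ht).symm
  simp_rw [hR]
  rw [← measure_biUnion_finset₀ ?_ fun k _ =>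
    (MeasurableSet.iUnion fun n => hRm k n).nullMeasurableSet]
  · refine measure_congr (Filter.eventuallyEq_set.2 ?_)
    filter_upwards [walkMeasure_ae hN, walkMeasure_ae_visit hN hτ hs] with p hp hpn
    have hsmono := strictMono_jumpTime hN hτ fun n => (hp n).2.2
    obtain ⟨n, hpn⟩ := hpn
    simp only [Set.mem_iUnion, Finset.mem_range, exists_prop]
    constructor
    · intro h
      refine ⟨p.1 n, (hp n).1, n, rfl, hpn.2.1, ?_⟩
      by_contra! hcon
      have h1 := h _ ⟨hpn.2.2.le, hcon⟩
      rw [walk_eq hsmono.monotone le_rfl (hsmono (n + 1).lt_succ_self),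
        walk_eq hsmono.monotone hpn.2.1 hpn.2.2] at h1
      exact (hp n).2.1 h1
    · rintro ⟨k, _, m, hm⟩ u hu
      rw [walk_eq hsmono.monotone (hm.2.1.trans hu.1) (hu.2.trans_lt hm.2.2),
        walk_eq hsmono.monotone hm.2.1 ((hRv k m hm).2.2)]
  · intro j _ k _ hjk
    refine AEDisjoint.iUnion_left_iff.2 fun m => AEDisjoint.iUnion_right_iff.2 fun n => ?_
    by_cases hmn : m = n
    · subst hmn
      exact (Set.disjoint_left.2 fun p hp hp' => hjk (hp.1.symm.trans hp'.1)).aedisjoint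
    · refine AEDisjoint.mono ?_ (hRv j m) (hRv k n)
      simpa [hmn, Ne.symm hmn, Function.onFun] using
        aedisjoint_visit hN hτ (fun l => if l = m then j else k) s hmn

end Walk

/-! ### The Poisson landscape -/

/-- An infinite set of reals with finitely many elements above each level can be listed in
decreasing order. -/
lemma exists_strictAnti_range {S : Set ℝ} (hS : S.Infinite)
    (hfin : ∀ a, (S ∩ Set.Ici a).Finite) : ∃ e : ℕ → ℝ, StrictAnti e ∧ Set.range e = S := by
  obtain ⟨m, hm, hmax⟩ : ∃ m ∈ S, ∀ y ∈ S, y ≤ m := by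
    obtain ⟨x₀, hx₀⟩ := hS.nonempty
    obtain ⟨m, hm, hmax⟩ := Set.exists_max_image (S ∩ Set.Ici x₀) id (hfin x₀) ⟨x₀, hx₀, Set.self_mem_Ici⟩
    refine ⟨m, hm.1, fun y hy => ?_⟩
    rcases le_total x₀ y with h | h
    · exact hmax y ⟨hy, h⟩
    · exact h.trans hm.2
  let : LocallyFiniteOrder (S : Type)ᵒᵈ := LocallyFiniteOrder.ofFiniteIcc fun a b => by
    refine Set.Finite.subset (((hfin (OrderDual.ofDual b : S)).preimage
      Subtype.val_injective.injOn).preimage OrderDual.ofDual.injective.injOn) ?_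
    intro z hz
    exact ⟨(OrderDual.ofDual z).2, hz.2⟩
  let : SuccOrder (S : Type)ᵒᵈ := LinearLocallyFiniteOrder.succOrder _
  let : PredOrder (S : Type)ᵒᵈ := LinearLocallyFiniteOrder.predOrder _
  let : OrderBot (S : Type)ᵒᵈ :=
    { bot := OrderDual.toDual ⟨m, hm⟩
      bot_le := fun a => hmax _ (OrderDual.ofDual a).2 }
  have : NoMaxOrder (S : Type)ᵒᵈ := ⟨fun a => by
    by_contra! hcon
    refine hS ((hfin (OrderDual.ofDual a : S)).subset fun y hy => ⟨hy, ?_⟩)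
    exact hcon (OrderDual.toDual ⟨y, hy⟩)⟩
  let f : (S : Type)ᵒᵈ ≃o ℕ := orderIsoNatOfLinearSuccPredArch
  refine ⟨fun n => (OrderDual.ofDual (f.symm n) : S), fun a b hab => f.symm.strictMono hab, ?_⟩
  ext y
  constructor
  · rintro ⟨n, rfl⟩
    exact (OrderDual.ofDual (f.symm n)).2
  · intro hy
    exact ⟨f (OrderDual.toDual ⟨y, hy⟩), by simp⟩

section SumDirac

variable {m : Measure ℝ}

lemma one_le_of_mem_points (hm : ∃ (S : Set ℕ) (x : ℕ → ℝ),
    m = Measure.sum (fun i : S => Measure.dirac (x i))) {y : ℝ} (hy : y ∈ points m) :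
    1 ≤ m {y} := by
  obtain ⟨S, x, rfl⟩ := hm
  have hy' : Measure.sum (fun i : S => Measure.dirac (x i)) {y} ≠ 0 := hy
  rw [Measure.sum_apply _ (measurableSet_singleton y)] at hy' ⊢
  obtain ⟨i, hi⟩ : ∃ i : S, Measure.dirac (x i) {y} ≠ 0 := by
    by_contra! hcon
    exact hy' (by simp [hcon])
  refine le_trans ?_ (ENNReal.le_tsum i)
  rw [Measure.dirac_apply' _ (measurableSet_singleton y)] at hi ⊢
  by_cases h : x i ∈ ({y} : Set ℝ)
  · simp [Set.indicator_of_mem h]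
  · simp [Set.indicator_of_notMem h] at hi

lemma points_infinite (hm : ∃ (S : Set ℕ) (x : ℕ → ℝ),
    m = Measure.sum (fun i : S => Measure.dirac (x i))) (hIci : ∀ a, m (Set.Ici a) ≠ ∞)
    (htop : m Set.univ = ∞) : (points m).Infinite := by
  intro hfin
  have h0 : m (points m)ᶜ = 0 := by
    obtain ⟨S, x, hx⟩ := hm
    have hmem : ∀ i : S, x i ∈ points m := by
      intro i h
      rw [hx, Measure.sum_apply _ (measurableSet_singleton _), ENNReal.tsum_eq_zero] at h
      simpa using h i
    have h1 : m (points m)ᶜ = ∑' i : S, Measure.dirac (x i) (points m)ᶜ := by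
      rw [← Measure.sum_apply _ hfin.measurableSet.compl, ← hx]
    rw [h1, ENNReal.tsum_eq_zero]
    intro i
    rw [Measure.dirac_apply' _ hfin.measurableSet.compl]
    simp [hmem i]
  have h1 : m (points m) < ∞ := by
    rw [← Set.biUnion_of_singleton (points m)]
    refine measure_biUnion_lt_top hfin fun y _ => ?_
    exact (measure_mono (Set.singleton_subset_iff.2 (Set.mem_Ici.2 le_rfl))).trans_lt
      (lt_top_iff_ne_top.2 (hIci y))
  have h2 := measure_add_measure_compl (μ := m) hfin.measurableSet
  rw [h0, add_zero, htop] at h2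
  exact h1.ne h2

lemma exists_isLandscape (hm : ∃ (S : Set ℕ) (x : ℕ → ℝ),
    m = Measure.sum (fun i : S => Measure.dirac (x i))) (hIci : ∀ a, m (Set.Ici a) ≠ ∞)
    (htop : m Set.univ = ∞) : ∃ e, IsLandscape e m := by
  refine exists_strictAnti_range (points_infinite hm hIci htop) fun a => ?_
  by_contra hcon
  refine hIci a (top_unique ?_)
  rw [← Set.Infinite.meas_eq_top (μ := m) hcon
    ⟨1, one_ne_zero, fun y hy => one_le_of_mem_points hm hy.1⟩]
  exact measure_mono Set.inter_subset_right

/-- Summability of the waiting times, from a bound on the number of points above each negative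
integer level. -/
lemma summable_exp_of_tsum {e : ℕ → ℝ} (he : IsLandscape e m) (hm : ∃ (S : Set ℕ) (x : ℕ → ℝ),
    m = Measure.sum (fun i : S => Measure.dirac (x i)))
    (hsum : ∑' n : ℕ, ENNReal.ofReal (Real.exp (-(n : ℝ))) * m (Set.Ici (-((n : ℝ) + 1))) ≠ ∞) :
    Summable fun i => Real.exp (e i) := by
  -- the number of levels above `-(n + 1)` is at most the mass of `m` there
  have hcount : ∀ a : ℝ, ∑' i, (Set.Ici a).indicator (fun _ => (1 : ℝ≥0∞)) (e i) ≤
      m (Set.Ici a) := by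
    intro a
    have h1 : ∀ i, (Set.Ici a).indicator (fun _ => (1 : ℝ≥0∞)) (e i) ≤ m ({e i} ∩ Set.Ici a) := by
      intro i
      by_cases h : e i ∈ Set.Ici a
      · rw [Set.indicator_of_mem h, Set.inter_eq_left.2 (Set.singleton_subset_iff.2 h)]
        exact one_le_of_mem_points hm (he.2 ▸ Set.mem_range_self i)
      · rw [Set.indicator_of_notMem h]
        exact zero_le
    refine (ENNReal.tsum_le_tsum h1).trans ((tsum_meas_le_meas_iUnion_of_disjoint m
      (fun i => (measurableSet_singleton _).inter measurableSet_Ici) fun i j hij => ?_).trans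
      (measure_mono (Set.iUnion_subset fun i => Set.inter_subset_right)))
    exact Set.disjoint_left.2 fun y hy hy' => hij (he.1.injective (hy.1.symm.trans hy'.1))
  set K := ENNReal.ofReal (max 1 (Real.exp (e 0)))
  have hle : ∀ i, ENNReal.ofReal (Real.exp (e i)) ≤ K * ∑' n : ℕ,
      ENNReal.ofReal (Real.exp (-(n : ℝ))) *
        (Set.Ici (-((n : ℝ) + 1))).indicator (fun _ => (1 : ℝ≥0∞)) (e i) := by
    intro i
    obtain ⟨n, hn, hen⟩ : ∃ n : ℕ, e i ∈ Set.Ici (-((n : ℝ) + 1)) ∧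
        Real.exp (e i) ≤ max 1 (Real.exp (e 0)) * Real.exp (-(n : ℝ)) := by
      refine ⟨⌊-e i⌋₊, ?_, ?_⟩
      · have := Nat.lt_floor_add_one (-e i)
        rw [Set.mem_Ici]
        linarith
      · rcases le_total 0 (e i) with h | h
        · rw [Nat.floor_of_nonpos (neg_nonpos.2 h)]
          simpa using Or.inr (he.1.antitone (Nat.zero_le i))
        · have h1 := Nat.floor_le (neg_nonneg.2 h)
          calc Real.exp (e i) ≤ Real.exp (-(⌊-e i⌋₊ : ℝ)) := Real.exp_le_exp.2 (by linarith)
            _ ≤ _ := le_mul_of_one_le_left (Real.exp_pos _).le (le_max_left _ _)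
    calc ENNReal.ofReal (Real.exp (e i)) ≤ K * (ENNReal.ofReal (Real.exp (-(n : ℝ))) *
          (Set.Ici (-((n : ℝ) + 1))).indicator (fun _ => (1 : ℝ≥0∞)) (e i)) := by
          rw [Set.indicator_of_mem hn, mul_one, ← ENNReal.ofReal_mul (by positivity)]
          exact ENNReal.ofReal_le_ofReal hen
      _ ≤ _ := by
          gcongr
          exact ENNReal.le_tsum n
  have htot : ∑' i, ENNReal.ofReal (Real.exp (e i)) ≠ ∞ := by
    refine ne_top_of_le_ne_top (ENNReal.mul_ne_top (a := K) ENNReal.ofReal_ne_top hsum)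
      ((ENNReal.tsum_le_tsum hle).trans ?_)
    rw [ENNReal.tsum_mul_left, ENNReal.tsum_comm]
    gcongr with n
    rw [ENNReal.tsum_mul_left]
    gcongr
    exact hcount _
  have := ENNReal.summable_toReal htot
  simpa [ENNReal.toReal_ofReal (Real.exp_pos _).le] using this

end SumDirac

lemma energyIntensity_Ici {α : ℝ} (hα : 0 < α) (a : ℝ) :
    energyIntensity α (Set.Ici a) = ENNReal.ofReal (Real.exp (-α * a)) := by
  rw [energyIntensity, withDensity_apply _ measurableSet_Ici, setLIntegral_congr Ioi_ae_eq_Ici.symm,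
    ← ofReal_integral_eq_lintegral_ofReal
      ((integrableOn_exp_mul_Ioi (neg_lt_zero.2 hα) a).const_mul α)
      (.of_forall fun E => mul_nonneg hα.le (Real.exp_pos _).le),
    integral_const_mul, integral_exp_mul_Ioi (neg_lt_zero.2 hα)]
  congr 1
  field_simp

lemma lintegral_natCast_poissonMeasure (r : ℝ≥0) :
    ∫⁻ n : ℕ, (n : ℝ≥0∞) ∂poissonMeasure r = r := by
  have hsucc : ∀ n : ℕ, ((n + 1 : ℕ) : ℝ≥0∞) * poissonMeasure r {n + 1} =
      r * poissonMeasure r {n} := by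
    intro n
    have h1 : ((n + 1 : ℕ) : ℝ≥0∞) = ENNReal.ofReal ((n + 1 : ℕ) : ℝ) := by
      rw [ENNReal.ofReal_natCast]
    rw [poissonMeasure_singleton, poissonMeasure_singleton, h1,
      ← ENNReal.ofReal_mul (by positivity), ← ENNReal.ofReal_coe_nnreal,
      ← ENNReal.ofReal_mul (by positivity), Nat.factorial_succ]
    congr 1
    push_cast
    have : ((n.factorial : ℕ) : ℝ) ≠ 0 := by positivity
    field_simp
    ring
  have hone : ∑' n, poissonMeasure r {n} = 1 := by
    have := lintegral_countable' (μ := poissonMeasure r) fun _ => (1 : ℝ≥0∞)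
    simpa using this.symm
  rw [lintegral_countable', tsum_eq_zero_add' ENNReal.summable, tsum_congr hsucc,
    ENNReal.tsum_mul_left, hone]
  simp

lemma tendsto_poissonMeasure_Iic (k : ℕ) :
    Tendsto (fun r : ℝ≥0 => poissonMeasure r (Set.Iic k)) atTop (𝓝 0) := by
  have h1 : ∀ r, poissonMeasure r (Set.Iic k) = ∑ j ∈ Finset.Iic k, poissonMeasure r {j} := by
    intro r
    rw [← Finset.coe_Iic, ← sum_measure_singleton]
  simp_rw [h1]
  rw [← Finset.sum_const_zero (s := Finset.Iic k)]
  refine tendsto_finsetSum _ fun j _ => ?_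
  simp_rw [poissonMeasure_singleton]
  rw [← ENNReal.ofReal_zero]
  refine ENNReal.tendsto_ofReal ?_
  have h2 := ((Real.tendsto_pow_mul_exp_neg_atTop_nhds_zero j).div_const (j.factorial : ℝ)).comp
    (NNReal.tendsto_coe_atTop.2 tendsto_id)
  rw [zero_div] at h2
  refine h2.congr fun r => ?_
  simp only [Function.comp, id]
  ring

section Poisson

variable {Ω : Type*} [MeasurableSpace Ω] {μ : Measure Ω} {α : ℝ}
  {P : Ω → Measure ℝ}

lemma IsPoissonPointProcess.measurable_apply {ν : Measure ℝ} (hP : IsPoissonPointProcess P ν μ)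
    {A : Set ℝ} (hA : MeasurableSet A) : Measurable fun ω => P ω A :=
  (Measure.measurable_coe hA).comp hP.measurable

lemma IsPoissonPointProcess.lintegral_apply {ν : Measure ℝ} (hP : IsPoissonPointProcess P ν μ)
    {A : Set ℝ} (hA : MeasurableSet A) (hν : ν A ≠ ∞) : ∫⁻ ω, P ω A ∂μ = ν A := by
  have h1 := lintegral_map (μ := μ) measurable_id (hP.measurable_apply hA)
  simp only [id] at h1
  have h2 := lintegral_map (μ := poissonMeasure (ν A).toNNReal) measurable_id
    (measurable_of_countable (Nat.cast : ℕ → ℝ≥0∞))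
  simp only [id] at h2
  rw [← h1, hP.poisson A hA hν, h2, lintegral_natCast_poissonMeasure, ENNReal.coe_toNNReal hν]

lemma ae_measure_Ici_ne_top (hα : 0 < α) (hP : IsPoissonPointProcess P (energyIntensity α) μ) :
    ∀ᵐ ω ∂μ, ∀ a, P ω (Set.Ici a) ≠ ∞ := by
  have h1 : ∀ᵐ ω ∂μ, ∀ n : ℕ, P ω (Set.Ici (-(n : ℝ))) < ∞ := by
    refine ae_all_iff.2 fun n => ae_lt_top (hP.measurable_apply measurableSet_Ici) ?_
    have : energyIntensity α (Set.Ici (-(n : ℝ))) ≠ ∞ := by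
      rw [energyIntensity_Ici hα]
      exact ENNReal.ofReal_ne_top
    rwa [hP.lintegral_apply measurableSet_Ici this]
  filter_upwards [h1] with ω hω a
  obtain ⟨n, hn⟩ := exists_nat_ge (-a)
  exact ne_top_of_le_ne_top (hω n).ne (measure_mono (Set.Ici_subset_Ici.2 (by linarith)))

lemma ae_measure_univ_eq_top (hα : 0 < α) (hP : IsPoissonPointProcess P (energyIntensity α) μ) :
    ∀ᵐ ω ∂μ, P ω Set.univ = ∞ := by
  have h1 : ∀ k : ℕ, ∀ᵐ ω ∂μ, ¬ P ω Set.univ ≤ k := by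
    intro k
    have hle : ∀ n : ℕ, μ {ω | P ω Set.univ ≤ k} ≤
        poissonMeasure (energyIntensity α (Set.Ici (-(n : ℝ)))).toNNReal (Set.Iic k) := by
      intro n
      have hfin : energyIntensity α (Set.Ici (-(n : ℝ))) ≠ ∞ := by
        rw [energyIntensity_Ici hα]
        exact ENNReal.ofReal_ne_top
      have h2 := congrArg (fun m => m (Set.Iic (k : ℝ≥0∞)))
        (hP.poisson _ measurableSet_Ici hfin)
      rw [Measure.map_apply (hP.measurable_apply measurableSet_Ici) measurableSet_Iic,
        Measure.map_apply (by fun_prop) measurableSet_Iic] at h2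
      have h3 : (Nat.cast : ℕ → ℝ≥0∞) ⁻¹' Set.Iic (k : ℝ≥0∞) = Set.Iic k := by
        ext j
        simp
      rw [← h3, ← h2]
      exact measure_mono fun ω hω => (measure_mono (Set.subset_univ _)).trans hω
    have hlim : Tendsto (fun n : ℕ => poissonMeasure
        (energyIntensity α (Set.Ici (-(n : ℝ)))).toNNReal (Set.Iic k)) atTop (𝓝 0) := by
      refine (tendsto_poissonMeasure_Iic k).comp ?_
      rw [← NNReal.tendsto_coe_atTop]
      have h2 : ∀ n : ℕ, ((energyIntensity α (Set.Ici (-(n : ℝ)))).toNNReal : ℝ) =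
          Real.exp (α * n) := by
        intro n
        rw [energyIntensity_Ici hα, ENNReal.coe_toNNReal_eq_toReal,
          ENNReal.toReal_ofReal (Real.exp_pos _).le, neg_mul_neg]
      simp_rw [h2]
      exact Real.tendsto_exp_atTop.comp (tendsto_natCast_atTop_atTop.const_mul_atTop hα)
    have h0 := le_antisymm (ge_of_tendsto' hlim hle) zero_le
    rw [ae_iff]
    simpa using h0
  filter_upwards [ae_all_iff.2 h1] with ω hω
  by_contra hcon
  obtain ⟨k, hk⟩ := ENNReal.exists_nat_gt hcon
  exact hω k hk.le

/-- This is where `α < 1` enters: the expected number of points above `-(n + 1)` is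
`exp (α * (n + 1))`, which is beaten by the weight `exp (-n)`. -/
lemma ae_tsum_measure_Ici_ne_top (hα : 0 < α) (hα1 : α < 1)
    (hP : IsPoissonPointProcess P (energyIntensity α) μ) :
    ∀ᵐ ω ∂μ, ∑' n : ℕ, ENNReal.ofReal (Real.exp (-(n : ℝ))) * P ω (Set.Ici (-((n : ℝ) + 1)))
      ≠ ∞ := by
  have hmeas : ∀ n : ℕ, Measurable fun ω =>
      ENNReal.ofReal (Real.exp (-(n : ℝ))) * P ω (Set.Ici (-((n : ℝ) + 1))) := fun n =>
    (hP.measurable_apply measurableSet_Ici).const_mul _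
  have key : ∫⁻ ω, ∑' n : ℕ, ENNReal.ofReal (Real.exp (-(n : ℝ))) *
      P ω (Set.Ici (-((n : ℝ) + 1))) ∂μ ≠ ∞ := by
    rw [lintegral_tsum fun n => (hmeas n).aemeasurable]
    have h1 : ∀ n : ℕ, ∫⁻ ω, ENNReal.ofReal (Real.exp (-(n : ℝ))) *
        P ω (Set.Ici (-((n : ℝ) + 1))) ∂μ =
          ENNReal.ofReal (Real.exp α * Real.exp (α - 1) ^ n) := by
      intro n
      rw [lintegral_const_mul' _ _ ENNReal.ofReal_ne_top, hP.lintegral_apply measurableSet_Ici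
        (by rw [energyIntensity_Ici hα]; exact ENNReal.ofReal_ne_top), energyIntensity_Ici hα,
        ← ENNReal.ofReal_mul (Real.exp_pos _).le, ← Real.exp_add, ← Real.exp_nat_mul,
        ← Real.exp_add]
      congr 2
      ring
    rw [tsum_congr h1]
    exact ((summable_geometric_of_lt_one (Real.exp_pos _).le
      (Real.exp_lt_one_iff.2 (by linarith))).mul_left _).tsum_ofReal_ne_top
  filter_upwards [ae_lt_top (Measurable.tsum hmeas) key] with ω hω
  exact hω.ne

end Poisson

/-! ### The infinite-volume limit in a fixed landscape -/

section Landscape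

variable {e : ℕ → ℝ} {τ₀ : ℝ}

lemma waitingTime_pos (hτ₀ : 0 < τ₀) (e : ℕ → ℝ) (i : ℕ) : 0 < waitingTime τ₀ e i :=
  div_pos (Real.exp_pos _) hτ₀

lemma inv_waitingTime (e : ℕ → ℝ) (i : ℕ) : (waitingTime τ₀ e i)⁻¹ = rate τ₀ e i := by
  rw [waitingTime, rate, inv_div, Real.exp_neg, div_eq_mul_inv]

lemma rate_injective (hτ₀ : 0 < τ₀) (he : StrictAnti e) : Function.Injective (rate τ₀ e) :=
  fun _ _ h => he.injective
    (neg_injective (Real.exp_injective (mul_left_cancel₀ hτ₀.ne' h)))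

lemma tendsto_numSites (hτ₀ : 0 < τ₀) (he : StrictAnti e) (hs : Summable (waitingTime τ₀ e)) :
    Tendsto (numSites e) atBot atTop := by
  have hfin : ∀ E, {i | E ≤ e i}.Finite := by
    intro E
    have h1 := hs.tendsto_cofinite_zero.eventually
      (gt_mem_nhds (div_pos (Real.exp_pos E) hτ₀))
    refine h1.subset fun i hi => ?_
    exact not_lt.2 (div_le_div_of_nonneg_right (Real.exp_le_exp.2 hi) hτ₀.le)
  refine tendsto_atTop.2 fun n => ?_
  filter_upwards [eventually_le_atBot (e n)] with E hE
  have h1 : (Finset.range n : Set ℕ) ⊆ {i | E ≤ e i} := fun i hi =>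
    hE.trans (he.antitone (Finset.mem_range.1 hi).le)
  calc n = (Finset.range n : Set ℕ).ncard := by rw [Set.ncard_coe_finset, Finset.card_range]
    _ ≤ _ := Set.ncard_le_ncard h1 (hfin E)

lemma occupationProb_eq (hτ₀ : 0 < τ₀) (he : StrictAnti e) (j : ℕ) {E t : ℝ}
    (hE : 2 ≤ numSites e E) (ht : 0 ≤ t) :
    occupationProb τ₀ e j E t = (siteProb (numSites e E) (waitingTime τ₀ e) j t).toReal := by
  rw [← walkMeasure_walk_eq hE (waitingTime_pos hτ₀ e) j ht, occupationProb, measureReal_def]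
  simp only [(rate_injective hτ₀ he).eq_iff, Y]

lemma correlation_eq (hτ₀ : 0 < τ₀) (e : ℕ → ℝ) {E t s : ℝ} (hE : 2 ≤ numSites e E)
    (hs : 0 ≤ s) (ht : 0 ≤ t) :
    correlation τ₀ e E t s = ∑ k ∈ Finset.range (numSites e E),
      (siteProb (numSites e E) (waitingTime τ₀ e) k s).toReal *
        Real.exp (-(rate τ₀ e k * (((numSites e E : ℝ) - 1) / numSites e E) * t)) := by
  have hτ := waitingTime_pos hτ₀ e
  simp only [correlation, Y, measureReal_def]
  rw [walkMeasure_stay hE hτ hs ht, ENNReal.toReal_sum fun k _ =>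
    ENNReal.mul_ne_top ENNReal.ofReal_ne_top
      (ne_top_of_le_ne_top ENNReal.one_ne_top (siteProb_le_one hE hτ k s))]
  refine Finset.sum_congr rfl fun k _ => ?_
  rw [ENNReal.toReal_mul, ENNReal.toReal_ofReal (Real.exp_pos _).le, mul_comm, exitRate, mul_inv,
    inv_div, inv_waitingTime]
  congr 4
  ring

end Landscape

end TrapModel

theorem proposition4p2 {Ω : Type*} [MeasurableSpace Ω] (μ : Measure Ω) [IsProbabilityMeasure μ]
    (α : ℝ) (hα0 : 0 < α) (hα1 : α < 1) (τ₀ : ℝ) (hτ₀ : 0 < τ₀)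
    (P : Ω → Measure ℝ)
    (hP : TrapModel.IsPoissonPointProcess P (TrapModel.energyIntensity α) μ) :
    ∀ᵐ ω ∂μ, ∃ e : ℕ → ℝ, TrapModel.IsLandscape e (P ω) ∧
      Summable (TrapModel.waitingTime τ₀ e) ∧
      (∀ j : ℕ, TrapModel.HasIteratedLimit
        (fun E t => TrapModel.occupationProb τ₀ e j E t)
        (TrapModel.waitingTime τ₀ e j / ∑' k, TrapModel.waitingTime τ₀ e k)) ∧
      (∀ θ : ℝ, 0 < θ → TrapModel.HasIteratedLimit
        (fun E tw => TrapModel.correlation τ₀ e E (θ * tw) tw) 0) ∧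
      (∀ t : ℝ, 0 < t → TrapModel.HasIteratedLimit
        (fun E tw => TrapModel.correlation τ₀ e E t tw)
        ((∑' i, TrapModel.waitingTime τ₀ e i * Real.exp (-TrapModel.rate τ₀ e i * t)) /
          ∑' i, TrapModel.waitingTime τ₀ e i)) := by
  open TrapModel in
  filter_upwards [ae_measure_Ici_ne_top hα0 hP, ae_measure_univ_eq_top hα0 hP,
    ae_tsum_measure_Ici_ne_top hα0 hα1 hP] with ω hIci htop hsum
  obtain ⟨e, he⟩ := exists_isLandscape (hP.sum_dirac ω) hIci htop
  have hsm : Summable (waitingTime τ₀ e) :=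
    (summable_exp_of_tsum he (hP.sum_dirac ω) hsum).div_const τ₀
  set τ := waitingTime τ₀ e
  have hτ : ∀ i, 0 < τ i := waitingTime_pos hτ₀ e
  have hx : ∀ i, 0 < (τ i)⁻¹ := fun i => inv_pos.2 (hτ i)
  have hmin : ∀ i, (τ 0)⁻¹ ≤ (τ i)⁻¹ := fun i => inv_anti₀ (hτ i)
    (div_le_div_of_nonneg_right (Real.exp_le_exp.2 (he.1.antitone (Nat.zero_le i))) hτ₀.le)
  set p : ℕ → ℕ → ℝ → ℝ := fun N k t => (siteProb N τ k t).toReal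
  have hp : ∀ N, 2 ≤ N → IsUniformFlow N (fun i => (τ i)⁻¹) (p N) := fun N hN =>
    isUniformFlow_siteProb hN hτ
  have hsx : Summable fun i => (τ i)⁻¹⁻¹ := by simpa using hsm
  have hN := tendsto_numSites hτ₀ he.1 hsm
  have hcorr : ∀ t s : ℝ, 0 < t → 0 < s → Tendsto (fun E => correlation τ₀ e E t s) atBot
      (𝓝 (∑' k, limitFlow p k s * Real.exp (-((τ k)⁻¹ * t)))) := by
    intro t s ht hs
    refine ((tendsto_sum_flow_mul_exp hp hx hsx hs ht).comp hN).congr' ?_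
    filter_upwards [hN.eventually_ge_atTop 2] with E hE
    rw [correlation_eq hτ₀ e hE hs.le ht.le]
    simp only [Function.comp, p, τ, inv_waitingTime]
  refine ⟨e, he, hsm, fun j => ⟨limitFlow p j, fun t ht => ?_, ?_⟩,
    fun θ hθ => ⟨_, fun t ht => hcorr (θ * t) t (mul_pos hθ ht) ht,
      tendsto_tsum_limitFlow_mul hp hx hsx hθ⟩, fun t ht => ⟨_, fun s hs => hcorr t s ht hs, ?_⟩⟩
  · refine ((tendsto_limitFlow hp hx hsx j ht).comp hN).congr' ?_
    filter_upwards [hN.eventually_ge_atTop 2] with E hE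
    exact (occupationProb_eq hτ₀ he.1 j hE ht.le).symm
  · simpa using tendsto_limitFlow_atTop hp hx hmin hsx j
  · have h1 := tendsto_tsum_limitFlow hp hx hmin hsx ht
    have h2 : ∀ i, (τ i)⁻¹ = rate τ₀ e i := fun i => inv_waitingTime e i
    simp only [inv_inv] at h1
    simpa only [h2, neg_mul] using h1
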